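/- A \emph{quadrilateral} $OABC$ in the Euclidean plane is given by four points $O,A,B,C$, no three of them collinear, such that no two of the sides $OA,AB,BC,CO$ have a common interior point (it may be convex or concave). It is a \emph{lattice equable quadrilateral} (LEQ) if $O,A,B,C\in\mathbb Z^2$ and its area equals its perimeter. It is a \emph{kite} if its sides fall into two pairs of adjacent sides of equal length. It is \emph{extangential} if it has an \emph{excircle}, that is, a circle exterior to the quadrilateral and tangent to the four lines that extend its sides; the vertices are then labelled so that the excircle lies outside the vertex $B$, that is, the line $AB$ and the line $BC$ each separate the centre of the excircle from $O$. Let $a,b,c,d$ denote the lengths of $OA,AB,BC,CO$, and put \[ \Sigma=8\cdot\frac{ad+bc+2\delta\sqrt{abcd-4(a+b)^2}}{16+(a-c)^2},\qquad T=8(a+b)^2\cdot\frac{ab+cd+2\delta\sqrt{abcd-4(a+b)^2}}{16(a+b)^2+(a-c)^2(a-d)^2}, \] where $\delta=1$ if $B$ lies within the circumcircle of the triangle $OAC$ and $\delta=-1$ otherwise. Theorem. If $OABC$ is an extangential LEQ that is not a kite, with the excircle outside $B$, then $\Sigma$ and $T$ are integers, and one of the following holds: (a) $(\Sigma,T)=(9,18)$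 or $(\Sigma,T)=(18,50)$; (b) $(\Sigma,T)=(5m^2,5m^2+5)$ for some integer $m$ for which there exist integers $n,Y,Z$ such that $m^2-10n^2=-1$ and $(5m^2-8)Y^2=5+8Z^2$; (c) $(\Sigma,T)=(m^2,m^2+1)$ for some integer $m$ for which there exist integers $n,Y,Z$ such that $m^2-2n^2=-1$ and $(m^2-8)Y^2=1+8Z^2$. -/

import Mathlib

open EuclideanGeometry

noncomputable section

/-- The Euclidean plane. -/
abbrev Plane : Type := EuclideanSpace ℝ (Fin 2)

/-- Four points `O, A, B, C` of the plane, listed in the cyclic order in which they are joined by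
the sides `OA`, `AB`, `BC`, `CO`. -/
structure Quad where
  O : Plane
  A : Plane
  B : Plane
  C : Plane

namespace Quad

/-- The length `a` of the side `OA`. -/
def a (Q : Quad) : ℝ := dist Q.O Q.A

/-- The length `b` of the side `AB`. -/
def b (Q : Quad) : ℝ := dist Q.A Q.B

/-- The length `c` of the side `BC`. -/
def c (Q : Quad) : ℝ := dist Q.B Q.C

/-- The length `d` of the side `CO`. -/
def d (Q : Quad) : ℝ := dist Q.C Q.O

/-- The perimeter. -/
def perimeter (Q : Quad) : ℝ := Q.a + Q.b + Q.c + Q.d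

/-- `OABC` is a quadrilateral: no three vertices are collinear, and no two sides have a common
interior point. (Two adjacent sides never have one when no three vertices are collinear.) -/
structure IsQuadrilateral (Q : Quad) : Prop where
  not_collinear_OAB : ¬ Collinear ℝ {Q.O, Q.A, Q.B}
  not_collinear_ABC : ¬ Collinear ℝ {Q.A, Q.B, Q.C}
  not_collinear_BCO : ¬ Collinear ℝ {Q.B, Q.C, Q.O}
  not_collinear_COA : ¬ Collinear ℝ {Q.C, Q.O, Q.A}
  disjoint_OA_BC : Disjoint (openSegment ℝ Q.O Q.A) (openSegment ℝ Q.B Q.C)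
  disjoint_AB_CO : Disjoint (openSegment ℝ Q.A Q.B) (openSegment ℝ Q.C Q.O)

open Classical in
/-- The closed region bounded by a quadrilateral. A quadrilateral, convex or concave, always has a
diagonal whose line strictly separates the two other vertices; such a diagonal lies inside the
quadrilateral and cuts it into two triangles. -/
def region (Q : Quad) : Set Plane :=
  if (line[ℝ, Q.O, Q.B]).SOppSide Q.A Q.C then
    convexHull ℝ {Q.O, Q.A, Q.B} ∪ convexHull ℝ {Q.O, Q.B, Q.C}
  else
    convexHull ℝ {Q.O, Q.A, Q.C} ∪ convexHull ℝ {Q.A, Q.B, Q.C}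

/-- The area: the two-dimensional Lebesgue measure of the bounded region. -/
def area (Q : Quad) : ℝ := (MeasureTheory.volume Q.region).toReal

/-- All four vertices lie on the integer lattice `ℤ²`. -/
def IsLattice (Q : Quad) : Prop :=
  ∀ P ∈ ({Q.O, Q.A, Q.B, Q.C} : Set Plane), ∀ i : Fin 2, ∃ n : ℤ, P i = n

/-- A lattice equable quadrilateral: its vertices are lattice points and its area equals its
perimeter. -/
structure IsLEQ (Q : Quad) : Prop where
  isQuadrilateral : Q.IsQuadrilateral
  isLattice : Q.IsLattice
  area_eq_perimeter : Q.area = Q.perimeter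

/-- A kite: the sides fall into two pairs of adjacent sides of equal length. -/
def IsKite (Q : Quad) : Prop :=
  (Q.a = Q.d ∧ Q.b = Q.c) ∨ (Q.a = Q.b ∧ Q.c = Q.d)

/-- `S` is an excircle: a circle exterior to the quadrilateral (its open disc does not meet the
bounded region) which is tangent to the four lines that extend the sides. -/
structure IsExcircle (Q : Quad) (S : Sphere Plane) : Prop where
  radius_pos : 0 < S.radius
  exterior : Disjoint (Metric.ball S.center S.radius) Q.region
  tangent_OA : S.IsTangent line[ℝ, Q.O, Q.A]
  tangent_AB : S.IsTangent line[ℝ, Q.A, Q.B]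
  tangent_BC : S.IsTangent line[ℝ, Q.B, Q.C]
  tangent_CO : S.IsTangent line[ℝ, Q.C, Q.O]

/-- The circle `S` lies outside the vertex `B`: both lines that carry the sides meeting at `B`
separate its center from the opposite vertex `O`. -/
def LiesOutsideB (Q : Quad) (S : Sphere Plane) : Prop :=
  (line[ℝ, Q.A, Q.B]).SOppSide Q.O S.center ∧ (line[ℝ, Q.B, Q.C]).SOppSide Q.O S.center

/-- The quadrilateral is extangential, with the vertices labelled so that its excircle lies
outside the vertex `B`. -/
def IsExtangential (Q : Quad) : Prop :=
  ∃ S : Sphere Plane, Q.IsExcircle S ∧ Q.LiesOutsideB S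

/-- `B` lies (strictly) within the circumcircle of the triangle `OAC`. -/
def BWithinCircumcircle (Q : Quad) : Prop :=
  ∃ S : Sphere Plane, Q.O ∈ S ∧ Q.A ∈ S ∧ Q.C ∈ S ∧ dist Q.B S.center < S.radius

open Classical in
/-- The sign `δ`. -/
def delta (Q : Quad) : ℝ := if Q.BWithinCircumcircle then 1 else -1

/-- The function `Σ`. -/
def Sig (Q : Quad) : ℝ :=
  8 * ((Q.a * Q.d + Q.b * Q.c
      + 2 * Q.delta * Real.sqrt (Q.a * Q.b * Q.c * Q.d - 4 * (Q.a + Q.b) ^ 2))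
    / (16 + (Q.a - Q.c) ^ 2))

/-- The function `T`. -/
def Tau (Q : Quad) : ℝ :=
  8 * (Q.a + Q.b) ^ 2 * ((Q.a * Q.b + Q.c * Q.d
      + 2 * Q.delta * Real.sqrt (Q.a * Q.b * Q.c * Q.d - 4 * (Q.a + Q.b) ^ 2))
    / (16 * (Q.a + Q.b) ^ 2 + (Q.a - Q.c) ^ 2 * (Q.a - Q.d) ^ 2))

end Quad

end

/-! Geometry turns the hypotheses into Diophantine equations. The excircle forces `a + b = c + d`
and `c < a`, and it makes the triangles `OAB` and `OBC`, of doubled areas `N` and `M`, lie on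
opposite sides of `OB` (`TangentConfig.shape`). Equability then reads `N + M = 4(a + b)`. Hence `a +
b` is rational, and since the sides have integer squares they are integers.

Put `S = ad(1 - cos O) = bc(1 - cos B)` and `T = ab(1 + cos A) = cd(1 + cos C)`; the two expressions
for each agree because `a + b = c + d`. Both are integers, since side lengths and scalar products of
lattice vectors are. The Bretschneider-type identity `W² = abcd - 4(a + b)²`, where `W` is positive
exactly when `B` is inside the circle `OAC`, identifies `S` with Σ and `T` with the quantity of the
theorem (`AreaRelations.sigma_eq`, `AreaRelations.tau_eq`).

With `x = a + b`, `y = |a - d|`, `z = a - c` and `2f = ±(M - N)`, the areas and the diagonals give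
`(S - 8)x² = T(y² + 2S)`, `TSz² = 8(T - S)x²` and `4xf = Tyz`. Moreover `f < 2x` because `N` and `M`
are positive, `y ≠ 0` because a kite is excluded, and `S(T - S) ≠ 8T` because no three vertices are
collinear.

Let `k = T - S > 0`. The second equation makes `2Sk(S + k)` a square. For `k ≤ 8` this writes `S`
and `S + k` as squares up to a few small factors (`Reduced.exists_of_eq`), and congruences exclude
every `k` except 1 and 5, which give the two Pell families. For `k ≥ 9` the bound `f < 2x` and its
counterpart for `z` reduce the problem to a finite search (`pair_of_equations`), which leaves the
two sporadic pairs. -/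

/-! ### Finite search for the pairs with T - Σ ≥ 9 -/

/-- `P` holds for all natural numbers below the given bound. -/
def allBelow (P : ℕ → Bool) : ℕ → Bool
  | 0 => true
  | n + 1 => P n && allBelow P n

theorem allBelow_apply {P : ℕ → Bool} {n i : ℕ} (h : allBelow P n = true) (hi : i < n) :
    P i = true := by
  induction n with
  | zero => omega
  | succ n ih =>
    simp only [allBelow, Bool.and_eq_true] at h
    rcases Nat.lt_succ_iff_lt_or_eq.1 hi with h' | h'
    · exact ih h.2 h'
    · exact h' ▸ h.1

/-- Boolean test for perfect squares. -/
def isSq (n : ℕ) : Bool := n.sqrt * n.sqrt == n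

theorem isSq_of_isSquare {n : ℕ} (h : IsSquare n) : isSq n = true := by
  obtain ⟨r, rfl⟩ := h
  simp [isSq, Nat.sqrt_eq]

/-- The square conditions satisfied by `s = Σ - 8`, `j = T - Σ - 8` and `y = a - d`. -/
def squareTest (s j y : ℕ) : Bool :=
  isSq (2 * (s + 8) * (j + 8) * (s + j + 16)) &&
    ((s + j + 16) * (y ^ 2 + 2 * (s + 8)) % s == 0 &&
      isSq ((s + j + 16) * (y ^ 2 + 2 * (s + 8)) * s) &&
      isSq (8 * (j + 8) * (y ^ 2 + 2 * (s + 8)) * ((s + 8) * s)))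

/-- The two pairs `(s, j)` that occur, and the pairs that belong to a degenerate quadrilateral. -/
def isListed (s j : ℕ) : Bool :=
  s * j == 64 || (s == 1 && j == 1) || (s == 10 && j == 24)

/-- No pair `(s, j)` outside the list passes the square tests for any admissible `y`. -/
def pairTest (s j : ℕ) : Bool :=
  !isSq (2 * (s + 8) * (j + 8) * (s + j + 16)) || isListed s j ||
    (decide (64 < s * j) &&
      allBelow (fun y => y == 0 || decide (16 * (s + 8) ^ 2 + 64 * y ^ 2 ≤ y ^ 2 * (s * j)) ||
        !squareTest s j y) (4 * (s + 8) + 1))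

/-- As `y ≥ 1`, the inequality `y²(sj - 64) < 16(s + 8)²` bounds `j` for each given `s`. The
threshold 17 matches the estimate `yz ≤ 44`, which is available once both `s` and `j` reach it. -/
theorem pairTest_small_left : allBelow (fun s => s == 0 ||
    allBelow (fun j => pairTest s j) ((64 + 16 * (s + 8) ^ 2) / s + 1)) 17 = true := by
  decide +kernel

/-- The mirror image: `z ≥ 1` in `z²(sj - 64) < 16(j + 8)²` bounds `s` for each given `j`. -/
theorem pairTest_small_right : allBelow (fun j => j == 0 ||
    allBelow (fun s => pairTest s j) ((64 + 16 * (j + 8) ^ 2) / j + 1)) 17 = true := by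
  decide +kernel

/-- The test for given `y`, `z`, `s`, where `j` is determined by the others. -/
def tripleTest (y z s : ℕ) : Bool :=
  let n := z ^ 2 * (s + 8) * s
  let m := 8 * (y ^ 2 + 2 * (s + 8))
  !(n % m == 0) || decide (n / m < 25) ||
    decide (16 * (s + 8) ^ 2 + 64 * y ^ 2 ≤ y ^ 2 * (s * (n / m - 8))) ||
    decide (s < 17) || !squareTest s (n / m - 8) y

/-- For `yz ≥ 17` the inequality `yzs < 8(y² + 2(s + 8))` rearranges to `(yz - 16)s < 8(y² + 16)`,
so `s` runs over a finite range. -/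
theorem tripleTest_large : allBelow (fun y => allBelow (fun z =>
    decide (y * z < 17) || decide (44 < y * z) ||
      allBelow (fun s => tripleTest y z s) (8 * (y ^ 2 + 16) / (y * z - 16) + 1)) 45) 45 = true := by
  decide +kernel

/-- For `yz ≤ 16` size alone does not bound `s`, but `y² + 2(s + 8)` divides `y²(y² + 16)z²`. The
search runs over the cofactor `i` and recovers `s` from it. -/
theorem tripleTest_small : allBelow (fun y => allBelow (fun z => y == 0 || z == 0 ||
    decide (16 < y * z) || allBelow (fun i => i == 0 ||
      !(y ^ 2 * (y ^ 2 + 16) * z ^ 2 % i == 0) ||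
      tripleTest y z ((y ^ 2 * (y ^ 2 + 16) * z ^ 2 / i - y ^ 2) / 2 - 8))
      (y ^ 2 * z ^ 2)) 17) 17 = true := by
  decide +kernel

set_option maxHeartbeats 1000000 in
/-- The pairs `(s, j)` that can occur when `Σ = s + 8` and `T = Σ + j + 8` with `s, j > 0`. -/
theorem pair_of_equations {s j x y z : ℕ} (hs : 0 < s) (hj : 0 < j) (hy : 0 < y) (hz : 0 < z)
    (hsq : IsSquare (2 * (s + 8) * (j + 8) * (s + j + 16)))
    (hx : s * x ^ 2 = (s + j + 16) * (y ^ 2 + 2 * (s + 8)))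
    (hzq : z ^ 2 * (s + 8) * s = 8 * (j + 8) * (y ^ 2 + 2 * (s + 8)))
    (hyb : y ^ 2 * (s * j) < 16 * (s + 8) ^ 2 + 64 * y ^ 2) (hne : s * j ≠ 64) :
    (s = 1 ∧ j = 1) ∨ (s = 10 ∧ j = 24) := by
  have htest : squareTest s j y = true := by
    simp only [squareTest, Bool.and_eq_true, beq_iff_eq]
    refine ⟨isSq_of_isSquare hsq, ⟨?_, isSq_of_isSquare ⟨s * x, ?_⟩⟩,
      isSq_of_isSquare ⟨z * (s + 8) * s, ?_⟩⟩
    · rw [← hx]; exact Nat.mul_mod_right _ _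
    · rw [← hx]; ring
    · rw [← hzq]; ring
  have of_pairTest : pairTest s j = true → (s = 1 ∧ j = 1) ∨ (s = 10 ∧ j = 24) := by
    intro h
    simp only [pairTest, isListed, Bool.or_eq_true, Bool.and_eq_true, beq_iff_eq,
      isSq_of_isSquare hsq, Bool.not_true, Bool.false_eq_true, false_or] at h
    rcases h with ((h | h) | h) | h
    · exact absurd h hne
    · exact Or.inl h
    · exact Or.inr h
    · have hlt : y < 4 * (s + 8) + 1 := by
        have : 65 ≤ s * j := of_decide_eq_true h.1
        nlinarith
      have := allBelow_apply (i := y) h.2 hlt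
      simp only [htest, Bool.or_eq_true, beq_iff_eq, decide_eq_true_eq, Bool.not_true,
        Bool.false_eq_true, or_false] at this
      omega
  -- With `w = sj - 64`, the bound on `y²w` gives `(y² + 2(s + 8))w < 2(s + 8)s(j + 8)`. Multiplying
  -- the equation for `z²` by `w` turns this into `z²w < 16(j + 8)²`, and `z ≥ 1`.
  have hzb : s * j < 64 + 16 * (j + 8) ^ 2 := by
    by_contra! hcon
    obtain ⟨w, hw⟩ : ∃ w, s * j = 64 + w := ⟨s * j - 64, by have := Nat.zero_le ((j+8)^2); omega⟩
    have h1 : y ^ 2 * w < 16 * (s + 8) ^ 2 := by nlinarith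
    have h2 : (y ^ 2 + 2 * (s + 8)) * w < 2 * (s + 8) * (s * (j + 8)) := by
      have : s * (j + 8) = 8 * (s + 8) + w := by linarith
      rw [this]; nlinarith
    have h3 : z ^ 2 * ((s + 8) * s * w) < 16 * (j + 8) ^ 2 * ((s + 8) * s) := by
      calc z ^ 2 * ((s + 8) * s * w) = z ^ 2 * (s + 8) * s * w := by ring
        _ = 8 * (j + 8) * ((y ^ 2 + 2 * (s + 8)) * w) := by rw [hzq]; ring
        _ < 8 * (j + 8) * (2 * (s + 8) * (s * (j + 8))) := by gcongr
        _ = _ := by ring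
    have h4 : (s + 8) * s * w ≤ z ^ 2 * ((s + 8) * s * w) :=
      Nat.le_mul_of_pos_left _ (by positivity)
    have h5 : w < 16 * (j + 8) ^ 2 := by
      have : (s + 8) * s * w < (s + 8) * s * (16 * (j + 8) ^ 2) := by linarith
      exact Nat.lt_of_mul_lt_mul_left this
    omega
  have hyb' : s * j < 64 + 16 * (s + 8) ^ 2 := by
    by_contra! hcon
    obtain ⟨w, hw⟩ : ∃ w, s * j = 64 + w := ⟨s * j - 64, by have := Nat.zero_le ((s+8)^2); omega⟩
    have h1 : y ^ 2 * w < 16 * (s + 8) ^ 2 := by nlinarith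
    have h4 : w ≤ y ^ 2 * w := Nat.le_mul_of_pos_left _ (by positivity)
    omega
  by_cases hs17 : s < 17
  · apply of_pairTest
    have h := allBelow_apply pairTest_small_left hs17
    simp only [Bool.or_eq_true, beq_iff_eq, hs.ne', false_or] at h
    have hlt : j < (64 + 16 * (s + 8) ^ 2) / s + 1 :=
      Nat.lt_succ_of_le ((Nat.le_div_iff_mul_le hs).2 (by linarith))
    have := allBelow_apply h hlt
    exact this
  by_cases hj17 : j < 17
  · apply of_pairTest
    have h := allBelow_apply pairTest_small_right hj17
    simp only [Bool.or_eq_true, beq_iff_eq, hj.ne', false_or] at h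
    have hlt : s < (64 + 16 * (j + 8) ^ 2) / j + 1 :=
      Nat.lt_succ_of_le ((Nat.le_div_iff_mul_le hj).2 (by linarith))
    have := allBelow_apply h hlt
    exact this
  exfalso
  push Not at hs17 hj17
  have of_tripleTest : tripleTest y z s = true → False := by
    intro h
    have hdiv : z ^ 2 * (s + 8) * s / (8 * (y ^ 2 + 2 * (s + 8))) = j + 8 := by
      rw [hzq, show 8 * (j + 8) * (y ^ 2 + 2 * (s + 8)) = (j + 8) * (8 * (y ^ 2 + 2 * (s + 8)))
        by ring]
      exact Nat.mul_div_cancel _ (by positivity)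
    have hmod : z ^ 2 * (s + 8) * s % (8 * (y ^ 2 + 2 * (s + 8))) = 0 := by
      rw [hzq, show 8 * (j + 8) * (y ^ 2 + 2 * (s + 8)) = (j + 8) * (8 * (y ^ 2 + 2 * (s + 8)))
        by ring]
      exact Nat.mul_mod_left _ _
    simp only [tripleTest, hdiv, hmod, Nat.add_sub_cancel, htest, Bool.or_eq_true,
      decide_eq_true_eq, Bool.not_true, Bool.false_eq_true, or_false, beq_self_eq_true,
      false_or] at h
    omega
  obtain ⟨w, hw⟩ : ∃ w, s * j = 64 + w := ⟨s * j - 64, by have := Nat.mul_le_mul hs17 hj17; omega⟩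
  have hyw : y ^ 2 * w < 16 * (s + 8) ^ 2 := by nlinarith
  have hqw : (y ^ 2 + 2 * (s + 8)) * w < 2 * (s + 8) * (s * (j + 8)) := by
    have : s * (j + 8) = 8 * (s + 8) + w := by linarith
    rw [this]; nlinarith
  have hzw : z ^ 2 * w < 16 * (j + 8) ^ 2 := by
    have : (s + 8) * s * (z ^ 2 * w) < (s + 8) * s * (16 * (j + 8) ^ 2) := by
      calc (s + 8) * s * (z ^ 2 * w) = z ^ 2 * (s + 8) * s * w := by ring
        _ = 8 * (j + 8) * ((y ^ 2 + 2 * (s + 8)) * w) := by rw [hzq]; ring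
        _ < 8 * (j + 8) * (2 * (s + 8) * (s * (j + 8))) := by gcongr
        _ = _ := by ring
    exact Nat.lt_of_mul_lt_mul_left this
  have hwpos : 0 < w := by have := Nat.mul_le_mul hs17 hj17; omega
  have hyz : y * z ≤ 44 := by
    have h1 : (y * z * w) ^ 2 < (16 * ((s + 8) * (j + 8))) ^ 2 := by
      calc (y * z * w) ^ 2 = (y ^ 2 * w) * (z ^ 2 * w) := by ring
        _ < (16 * (s + 8) ^ 2) * (16 * (j + 8) ^ 2) := by gcongr
        _ = _ := by ring
    have h2 : y * z * w < 16 * ((s + 8) * (j + 8)) := lt_of_pow_lt_pow_left₀ 2 (by positivity) h1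
    by_contra! hcon
    -- 45 is the first value that `s, j ≥ 17` rule out: at `s = j = 17`, `45(sj - 64) = 10125`
    -- exceeds `16(s + 8)(j + 8) = 10000`, and the gap grows with `s` and `j`.
    have h3 : 45 * w ≤ y * z * w := by gcongr; omega
    have h4 : 45 * w < 16 * ((s + 8) * (j + 8)) := by omega
    obtain ⟨s', rfl⟩ := Nat.exists_eq_add_of_le hs17
    obtain ⟨j', rfl⟩ := Nat.exists_eq_add_of_le hj17
    nlinarith [Nat.zero_le (s' * j')]
  have hyw2 : y * z * s < 8 * (y ^ 2 + 2 * (s + 8)) := by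
    have h1 : y ^ 2 * (s * (j + 8)) < 8 * (s + 8) * (y ^ 2 + 2 * (s + 8)) := by
      have : s * (j + 8) = 8 * (s + 8) + w := by linarith
      rw [this]; nlinarith
    have h2 : (s + 8) * (y * z * s) ^ 2 < (s + 8) * (8 * (y ^ 2 + 2 * (s + 8))) ^ 2 := by
      calc (s + 8) * (y * z * s) ^ 2 = y ^ 2 * s * (z ^ 2 * (s + 8) * s) := by ring
        _ = 8 * (y ^ 2 + 2 * (s + 8)) * (y ^ 2 * (s * (j + 8))) := by rw [hzq]; ring
        _ < 8 * (y ^ 2 + 2 * (s + 8)) * (8 * (s + 8) * (y ^ 2 + 2 * (s + 8))) := by gcongr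
        _ = _ := by ring
    exact lt_of_pow_lt_pow_left₀ 2 (by positivity) (Nat.lt_of_mul_lt_mul_left h2)
  have hyle : y ≤ y * z := Nat.le_mul_of_pos_right y hz
  have hzle : z ≤ y * z := Nat.le_mul_of_pos_left z hy
  have hy45 : y < 45 := by omega
  have hz45 : z < 45 := by omega
  by_cases hyz' : y * z < 17
  -- The product `(y² + 2(s + 8))(y² - 2s)` equals `y²(y² + 16) - 4s(s + 8)`, and `4s(s + 8)z²` is a
  -- multiple of `y² + 2(s + 8)` by the equation for `z²`.
  · obtain ⟨i, hi⟩ : y ^ 2 + 2 * (s + 8) ∣ y ^ 2 * (y ^ 2 + 16) * z ^ 2 := by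
      zify
      refine ⟨32 * (j + 8) - (2 * s - y ^ 2) * z ^ 2, ?_⟩
      zify at hzq
      linear_combination 4 * hzq
    have hipos : 0 < i := by
      rcases Nat.eq_zero_or_pos i with h0 | h0
      · have : 0 < y ^ 2 * (y ^ 2 + 16) * z ^ 2 := by positivity
        rw [hi, h0] at this
        omega
      · exact h0
    have hilt : i < y ^ 2 * z ^ 2 := by
      have h1 : (y ^ 2 + 2 * (s + 8)) * i < (y ^ 2 + 2 * (s + 8)) * (y ^ 2 * z ^ 2) := by
        calc (y ^ 2 + 2 * (s + 8)) * i = (y ^ 2 + 16) * (y ^ 2 * z ^ 2) := by rw [← hi]; ring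
          _ < _ := by gcongr 1; omega
      exact Nat.lt_of_mul_lt_mul_left h1
    apply of_tripleTest
    have hy17 : y < 17 := by omega
    have hz17 : z < 17 := by omega
    have h := allBelow_apply tripleTest_small hy17
    have h := allBelow_apply h hz17
    have hyz16 : ¬ 16 < y * z := by omega
    simp only [Bool.or_eq_true, decide_eq_true_eq, beq_iff_eq, hy.ne', hz.ne', hyz16,
      false_or] at h
    have h := allBelow_apply h hilt
    have hdiv : (y ^ 2 + 2 * (s + 8)) * i / i = y ^ 2 + 2 * (s + 8) := Nat.mul_div_cancel _ hipos
    have hs' : (y ^ 2 + 2 * (s + 8) - y ^ 2) / 2 - 8 = s := by omega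
    simpa only [hi, hdiv, hs', Nat.mul_mod_left, hipos.ne', Bool.or_eq_true, beq_iff_eq,
      Bool.not_true, beq_self_eq_true, Bool.false_eq_true, false_or] using h
  · apply of_tripleTest
    have h := allBelow_apply tripleTest_large hy45
    have h := allBelow_apply h hz45
    have hyz44 : ¬ 44 < y * z := not_lt.2 hyz
    simp only [Bool.or_eq_true, decide_eq_true_eq, hyz', hyz44, false_or] at h
    have hlt : s < 8 * (y ^ 2 + 16) / (y * z - 16) + 1 := by
      refine Nat.lt_succ_of_le ((Nat.le_div_iff_mul_le (by omega)).2 ?_)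
      obtain ⟨v, hv⟩ := Nat.exists_eq_add_of_le (not_lt.1 hyz')
      have : y * z - 16 = v + 1 := by omega
      rw [this]
      rw [hv] at hyw2
      linarith
    have := allBelow_apply h hlt
    exact this

/-! ### Square factors of coprime products, and squares modulo 8, 3, 5 and 7 -/

theorem eq_of_mul_eq_sq_of_squarefree {c m t : ℕ} (hc : Squarefree c) (hm : Squarefree m)
    (h : c * m = t ^ 2) : m = c := by
  obtain ⟨r, rfl⟩ : c ∣ t := (hc.dvd_pow_iff_dvd two_ne_zero).1 (h ▸ Dvd.intro m rfl)
  have hcpos : 0 < c := Nat.pos_of_ne_zero hc.ne_zero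
  have hmr : m = c * (r * r) := Nat.eq_of_mul_eq_mul_left hcpos (by rw [h]; ring)
  have hr : r = 1 := Nat.isUnit_iff.1 (hm r ⟨c, by rw [hmr]; ring⟩)
  rw [hmr, hr]; ring

/-- If the product of two coprime numbers is a square up to a squarefree factor `c`, then each is
a square up to a factor of `c`. -/
theorem exists_eq_mul_sq_of_coprime {c A B w : ℕ} (hc : Squarefree c) (hAB : A.Coprime B)
    (hA : 0 < A) (hB : 0 < B) (h : c * A * B = w ^ 2) :
    ∃ d₁ d₂ u v : ℕ, d₁ * d₂ = c ∧ A = d₁ * u ^ 2 ∧ B = d₂ * v ^ 2 ∧ u.Coprime v ∧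
      0 < u ∧ 0 < v := by
  obtain ⟨a, u, rfl, ha⟩ := Nat.sq_mul_squarefree A
  obtain ⟨b, v, rfl, hb⟩ := Nat.sq_mul_squarefree B
  have hu : 0 < u := by rcases Nat.eq_zero_or_pos u with h0 | h0 <;> simp_all
  have hv : 0 < v := by rcases Nat.eq_zero_or_pos v with h0 | h0 <;> simp_all
  have hab : a.Coprime b := Nat.Coprime.coprime_dvd_left (Dvd.intro_left _ rfl)
    (Nat.Coprime.coprime_dvd_right (Dvd.intro_left _ rfl) hAB)
  have huv : u.Coprime v := Nat.Coprime.coprime_dvd_left ⟨u * a, by ring⟩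
    (Nat.Coprime.coprime_dvd_right ⟨v * b, by ring⟩ hAB)
  obtain ⟨t, rfl⟩ : u * v ∣ w :=
    (Nat.pow_dvd_pow_iff two_ne_zero).1 ⟨c * (a * b), by rw [← h]; ring⟩
  have ht : c * (a * b) = t ^ 2 := by
    have hpos : 0 < (u * v) ^ 2 := by positivity
    exact Nat.eq_of_mul_eq_mul_left hpos (by linarith)
  refine ⟨a, b, u, v, eq_of_mul_eq_sq_of_squarefree hc ?_ ht, by ring, by ring, huv, hu, hv⟩
  exact (Nat.squarefree_mul hab).2 ⟨ha, hb⟩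

theorem Int.two_dvd_or_sq (n : ℤ) : (∃ m, n = 2 * m) ∨ ∃ t, n ^ 2 = 8 * t + 1 := by
  rcases Int.even_or_odd' n with ⟨m, h | h⟩
  · exact Or.inl ⟨m, h⟩
  · right
    rcases Int.even_or_odd' m with ⟨r, h' | h'⟩
    · exact ⟨2 * r ^ 2 + r, by rw [h, h']; ring⟩
    · exact ⟨2 * r ^ 2 + 3 * r + 1, by rw [h, h']; ring⟩

theorem Int.three_dvd_or_sq (n : ℤ) : (∃ m, n = 3 * m) ∨ ∃ t, n ^ 2 = 3 * t + 1 := by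
  obtain ⟨m, h | h | h⟩ : ∃ m, n = 3 * m ∨ n = 3 * m + 1 ∨ n = 3 * m + 2 := ⟨n / 3, by omega⟩
  · exact Or.inl ⟨m, h⟩
  · exact Or.inr ⟨3 * m ^ 2 + 2 * m, by rw [h]; ring⟩
  · exact Or.inr ⟨3 * m ^ 2 + 4 * m + 1, by rw [h]; ring⟩

theorem Int.five_dvd_or_sq (n : ℤ) :
    (∃ m, n = 5 * m) ∨ ∃ t, n ^ 2 = 5 * t + 1 ∨ n ^ 2 = 5 * t + 4 := by
  obtain ⟨m, h | h | h | h | h⟩ : ∃ m, n = 5 * m ∨ n = 5 * m + 1 ∨ n = 5 * m + 2 ∨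
    n = 5 * m + 3 ∨ n = 5 * m + 4 := ⟨n / 5, by omega⟩
  · exact Or.inl ⟨m, h⟩
  · exact Or.inr ⟨5 * m ^ 2 + 2 * m, by rw [h]; left; ring⟩
  · exact Or.inr ⟨5 * m ^ 2 + 4 * m, by rw [h]; right; ring⟩
  · exact Or.inr ⟨5 * m ^ 2 + 6 * m + 1, by rw [h]; right; ring⟩
  · exact Or.inr ⟨5 * m ^ 2 + 8 * m + 3, by rw [h]; left; ring⟩

theorem Int.seven_dvd_or_sq (n : ℤ) :
    (∃ m, n = 7 * m) ∨ ∃ t, n ^ 2 = 7 * t + 1 ∨ n ^ 2 = 7 * t + 2 ∨ n ^ 2 = 7 * t + 4 := by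
  obtain ⟨m, h | h | h | h | h | h | h⟩ : ∃ m, n = 7 * m ∨ n = 7 * m + 1 ∨ n = 7 * m + 2 ∨
    n = 7 * m + 3 ∨ n = 7 * m + 4 ∨ n = 7 * m + 5 ∨ n = 7 * m + 6 := ⟨n / 7, by omega⟩
  · exact Or.inl ⟨m, h⟩
  · exact Or.inr ⟨7 * m ^ 2 + 2 * m, by rw [h]; left; ring⟩
  · exact Or.inr ⟨7 * m ^ 2 + 4 * m, by rw [h]; right; right; ring⟩
  · exact Or.inr ⟨7 * m ^ 2 + 6 * m + 1, by rw [h]; right; left; ring⟩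
  · exact Or.inr ⟨7 * m ^ 2 + 8 * m + 2, by rw [h]; right; left; ring⟩
  · exact Or.inr ⟨7 * m ^ 2 + 10 * m + 3, by rw [h]; right; right; ring⟩
  · exact Or.inr ⟨7 * m ^ 2 + 12 * m + 5, by rw [h]; left; ring⟩

/-! ### The reduced system and its congruence obstructions -/

/-- The equations satisfied by `Σ = S` and `T = S + k`, after elimination of `a + b`. -/
structure Reduced (S k y z f : ℕ) : Prop where
  f_eq : 2 * S * f ^ 2 = k * (S + k) * y ^ 2
  z_eq : (S : ℤ) * (S - 8) * z ^ 2 = 8 * k * (y ^ 2 + 2 * S)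

theorem dvd_of_mul_sq_eq {p q f y : ℕ} (hpq : p.Coprime q) (h : (p * f) ^ 2 = (q * y) ^ 2) :
    ∃ Y, y = p * Y := by
  have h' : p * f = q * y := Nat.pow_left_injective two_ne_zero h
  exact hpq.dvd_of_dvd_mul_left ⟨f, h'.symm⟩

section FamilyExclusion

variable {u v Y z : ℤ}

/-- A 2-adic descent, used in the same way in most lemmas of this section: an odd square is `8t +
1`, so parity forces the variables to be even one by one, powers of 2 are cancelled, and finally
every parity pattern fails modulo a power of 2. Here the Pell equation first makes `u` even. -/
theorem no_solution_one (huv : v ^ 2 = 2 * u ^ 2 + 1)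
    (h : (u ^ 2 - 4) * z ^ 2 = 8 * (Y ^ 2 + 1)) : False := by
  obtain ⟨p, rfl⟩ | ⟨t, ht⟩ := Int.two_dvd_or_sq u
  · have h : (p ^ 2 - 1) * z ^ 2 = 2 * (Y ^ 2 + 1) := by linarith
    obtain ⟨r, rfl⟩ | ⟨t, ht⟩ := Int.two_dvd_or_sq p
    · obtain ⟨w, rfl⟩ | ⟨a, ha⟩ := Int.two_dvd_or_sq z
      · have h : 2 * (4 * r ^ 2 - 1) * w ^ 2 = Y ^ 2 + 1 := by linarith
        obtain ⟨b, rfl⟩ | ⟨b, hb⟩ := Int.two_dvd_or_sq Y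
        · ring_nf at h; omega
        · obtain ⟨c, rfl⟩ | ⟨c, hc⟩ := Int.two_dvd_or_sq w
          · rw [hb] at h; ring_nf at h; omega
          · rw [hb, hc] at h; ring_nf at h; omega
      · rw [ha] at h; ring_nf at h; omega
    · obtain ⟨b, rfl⟩ | ⟨b, hb⟩ := Int.two_dvd_or_sq Y
      · rw [ht] at h; ring_nf at h; omega
      · rw [hb, ht] at h; ring_nf at h; omega
  · obtain ⟨b, rfl⟩ | ⟨b, hb⟩ := Int.two_dvd_or_sq v
    · ring_nf at huv; omega
    · omega

/-- The prime 3 divides `Y`, then `z`; after cancelling 9 it would divide `Y² + 1`, but -1 is not a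
square modulo 3. -/
theorem no_solution_three_left (h : 3 * (9 * u ^ 2 - 4) * z ^ 2 = 8 * (Y ^ 2 + 9)) : False := by
  obtain ⟨W, rfl⟩ | ⟨t, ht⟩ := Int.three_dvd_or_sq Y
  · obtain ⟨w, rfl⟩ | ⟨a, ha⟩ := Int.three_dvd_or_sq z
    · obtain ⟨V, rfl⟩ | ⟨t, ht⟩ := Int.three_dvd_or_sq W
      · ring_nf at h; omega
      · have h : 3 * (9 * u ^ 2 - 4) * w ^ 2 = 8 * (W ^ 2 + 1) := by linarith
        rw [ht] at h; ring_nf at h; omega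
    · rw [ha] at h; ring_nf at h; omega
  · rw [ht] at h; ring_nf at h; omega

theorem no_solution_three_right (huv : 3 * v ^ 2 = 2 * u ^ 2 + 1)
    (h : (3 * u ^ 2 - 4) * z ^ 2 = 8 * (Y ^ 2 + 3)) : False := by
  obtain ⟨p, rfl⟩ | ⟨t, ht⟩ := Int.two_dvd_or_sq u
  · obtain ⟨b, rfl⟩ | ⟨b, hb⟩ := Int.two_dvd_or_sq v
    · ring_nf at huv; omega
    · ring_nf at huv; omega
  · rw [ht] at h
    obtain ⟨w, rfl⟩ | ⟨a, ha⟩ := Int.two_dvd_or_sq z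
    · obtain ⟨w, rfl⟩ | ⟨a, ha⟩ := Int.two_dvd_or_sq w
      · have h : 2 * (3 * (8 * t + 1) - 4) * w ^ 2 = Y ^ 2 + 3 := by linarith
        obtain ⟨b, rfl⟩ | ⟨b, hb⟩ := Int.two_dvd_or_sq Y
        · ring_nf at h; omega
        · rw [hb] at h
          obtain ⟨w, rfl⟩ | ⟨a, ha⟩ := Int.two_dvd_or_sq w
          · ring_nf at h; omega
          · rw [ha] at h; ring_nf at h; omega
      · have h : (3 * (8 * t + 1) - 4) * w ^ 2 = 2 * (Y ^ 2 + 3) := by linarith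
        rw [ha] at h; ring_nf at h; omega
    · rw [ha] at h; ring_nf at h; omega

theorem no_solution_four_left (huv : u ^ 2 + 1 = 2 * v ^ 2)
    (h : (u ^ 2 - 2) * z ^ 2 = 2 * (Y ^ 2 + 8)) : False := by
  obtain ⟨p, rfl⟩ | ⟨t, ht⟩ := Int.two_dvd_or_sq u
  · ring_nf at huv; omega
  · rw [ht] at h
    obtain ⟨z, rfl⟩ | ⟨a, ha⟩ := Int.two_dvd_or_sq z
    · have h : 2 * (8 * t - 1) * z ^ 2 = Y ^ 2 + 8 := by linarith
      obtain ⟨Y, rfl⟩ | ⟨b, hb⟩ := Int.two_dvd_or_sq Y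
      · have h : (8 * t - 1) * z ^ 2 = 2 * Y ^ 2 + 4 := by linarith
        obtain ⟨z, rfl⟩ | ⟨a, ha⟩ := Int.two_dvd_or_sq z
        · have h : 2 * (8 * t - 1) * z ^ 2 = Y ^ 2 + 2 := by linarith
          obtain ⟨Y, rfl⟩ | ⟨b, hb⟩ := Int.two_dvd_or_sq Y
          · have h : (8 * t - 1) * z ^ 2 = 2 * Y ^ 2 + 1 := by linarith
            obtain ⟨z, rfl⟩ | ⟨a, ha⟩ := Int.two_dvd_or_sq z
            · ring_nf at h; omega
            · rw [ha] at h
              obtain ⟨Y, rfl⟩ | ⟨b, hb⟩ := Int.two_dvd_or_sq Y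
              · ring_nf at h; omega
              · rw [hb] at h; ring_nf at h; omega
          · rw [hb] at h; ring_nf at h; omega
        · rw [ha] at h; ring_nf at h; omega
      · rw [hb] at h; ring_nf at h; omega
    · rw [ha] at h; ring_nf at h; omega

theorem no_solution_four_right (huv : v ^ 2 = 2 * u ^ 2 + 1)
    (h : 2 * (u ^ 2 - 1) * z ^ 2 = Y ^ 2 + 16) : False := by
  obtain ⟨u, rfl⟩ | ⟨t, ht⟩ := Int.two_dvd_or_sq u
  · obtain ⟨Y, rfl⟩ | ⟨b, hb⟩ := Int.two_dvd_or_sq Y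
    · have h : (4 * u ^ 2 - 1) * z ^ 2 = 2 * (Y ^ 2 + 4) := by linarith
      obtain ⟨z, rfl⟩ | ⟨a, ha⟩ := Int.two_dvd_or_sq z
      · have h : 2 * (4 * u ^ 2 - 1) * z ^ 2 = Y ^ 2 + 4 := by linarith
        obtain ⟨Y, rfl⟩ | ⟨b, hb⟩ := Int.two_dvd_or_sq Y
        · have h : (4 * u ^ 2 - 1) * z ^ 2 = 2 * (Y ^ 2 + 1) := by linarith
          obtain ⟨z, rfl⟩ | ⟨a, ha⟩ := Int.two_dvd_or_sq z
          · have h : 2 * (4 * u ^ 2 - 1) * z ^ 2 = Y ^ 2 + 1 := by linarith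
            obtain ⟨Y, rfl⟩ | ⟨b, hb⟩ := Int.two_dvd_or_sq Y
            · ring_nf at h; omega
            · rw [hb] at h
              obtain ⟨z, rfl⟩ | ⟨a, ha⟩ := Int.two_dvd_or_sq z
              · ring_nf at h; omega
              · rw [ha] at h; ring_nf at h; omega
          · rw [ha] at h; ring_nf at h; omega
        · rw [hb] at h; ring_nf at h; omega
      · rw [ha] at h; ring_nf at h; omega
    · rw [hb] at h; ring_nf at h; omega
  · obtain ⟨b, rfl⟩ | ⟨b, hb⟩ := Int.two_dvd_or_sq v
    · ring_nf at huv; omega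
    · omega

/-- Cancelling 25 leaves `Y² + 1`, and -1 is a square modulo 5, so the obstruction has to come from
2 instead, with `u` even by the Pell equation. -/
theorem no_solution_five (huv : v ^ 2 = 10 * u ^ 2 + 1)
    (h : 5 * (25 * u ^ 2 - 4) * z ^ 2 = 8 * (Y ^ 2 + 25)) : False := by
  obtain ⟨u, rfl⟩ | ⟨t, ht⟩ := Int.two_dvd_or_sq u
  · obtain ⟨Y, rfl⟩ | ⟨t, ht | ht⟩ := Int.five_dvd_or_sq Y
    · obtain ⟨z, rfl⟩ | ⟨t, ht | ht⟩ := Int.five_dvd_or_sq z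
      · have h : 5 * (25 * u ^ 2 - 1) * z ^ 2 = 2 * (Y ^ 2 + 1) := by linarith
        obtain ⟨u, rfl⟩ | ⟨t, ht⟩ := Int.two_dvd_or_sq u
        · obtain ⟨z, rfl⟩ | ⟨a, ha⟩ := Int.two_dvd_or_sq z
          · have h : 10 * (100 * u ^ 2 - 1) * z ^ 2 = Y ^ 2 + 1 := by linarith
            obtain ⟨Y, rfl⟩ | ⟨b, hb⟩ := Int.two_dvd_or_sq Y
            · ring_nf at h; omega
            · rw [hb] at h
              obtain ⟨z, rfl⟩ | ⟨a, ha⟩ := Int.two_dvd_or_sq z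
              · ring_nf at h; omega
              · rw [ha] at h; ring_nf at h; omega
          · rw [ha] at h; ring_nf at h; omega
        · rw [ht] at h
          obtain ⟨Y, rfl⟩ | ⟨b, hb⟩ := Int.two_dvd_or_sq Y
          · ring_nf at h; omega
          · rw [hb] at h; ring_nf at h; omega
      all_goals rw [ht] at h; ring_nf at h; omega
    all_goals rw [ht] at h; ring_nf at h; omega
  · obtain ⟨b, rfl⟩ | ⟨b, hb⟩ := Int.two_dvd_or_sq v
    · ring_nf at huv; omega
    · omega

theorem no_solution_six_left (huv : u ^ 2 + 2 = 3 * v ^ 2) (hu : ¬ 2 ∣ u)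
    (h : (3 * u ^ 2 - 8) * z ^ 2 = 16 * (Y ^ 2 + 6)) : False := by
  obtain ⟨u, rfl⟩ | ⟨t, ht⟩ := Int.two_dvd_or_sq u
  · exact hu ⟨u, rfl⟩
  · rw [ht] at h
    obtain ⟨z, rfl⟩ | ⟨a, ha⟩ := Int.two_dvd_or_sq z
    · obtain ⟨z, rfl⟩ | ⟨a, ha⟩ := Int.two_dvd_or_sq z
      · have h : (24 * t - 5) * z ^ 2 = Y ^ 2 + 6 := by linarith
        obtain ⟨Y, rfl⟩ | ⟨b, hb⟩ := Int.two_dvd_or_sq Y <;>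
          obtain ⟨z, rfl⟩ | ⟨a, ha⟩ := Int.two_dvd_or_sq z
        · ring_nf at h; omega
        · rw [ha] at h; ring_nf at h; omega
        · rw [hb] at h; ring_nf at h; omega
        · rw [ha, hb] at h; ring_nf at h; omega
      · have h : (24 * t - 5) * z ^ 2 = 4 * (Y ^ 2 + 6) := by linarith
        rw [ha] at h; ring_nf at h; omega
    · rw [ha] at h; ring_nf at h; omega

theorem no_solution_six_right (h : 3 * (9 * u ^ 2 - 4) * z ^ 2 = 4 * (Y ^ 2 + 36)) : False := by
  obtain ⟨Y, rfl⟩ | ⟨t, ht⟩ := Int.three_dvd_or_sq Y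
  · obtain ⟨z, rfl⟩ | ⟨a, ha⟩ := Int.three_dvd_or_sq z
    · have h : 3 * (9 * u ^ 2 - 4) * z ^ 2 = 4 * (Y ^ 2 + 4) := by linarith
      obtain ⟨Y, rfl⟩ | ⟨t, ht⟩ := Int.three_dvd_or_sq Y
      · ring_nf at h; omega
      · rw [ht] at h; ring_nf at h; omega
    · rw [ha] at h; ring_nf at h; omega
  · rw [ht] at h; ring_nf at h; omega

/-- As for 3: neither -1 nor -2 (in the next lemma) is a square modulo 7. -/
theorem no_solution_seven_left (h : 7 * (98 * u ^ 2 - 8) * z ^ 2 = 16 * (Y ^ 2 + 49)) :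
    False := by
  obtain ⟨Y, rfl⟩ | ⟨t, ht | ht | ht⟩ := Int.seven_dvd_or_sq Y
  · obtain ⟨z, rfl⟩ | ⟨t, ht | ht | ht⟩ := Int.seven_dvd_or_sq z
    · have h : 7 * (49 * u ^ 2 - 4) * z ^ 2 = 8 * (Y ^ 2 + 1) := by linarith
      obtain ⟨Y, rfl⟩ | ⟨t, ht | ht | ht⟩ := Int.seven_dvd_or_sq Y
      · ring_nf at h; omega
      all_goals rw [ht] at h; ring_nf at h; omega
    all_goals rw [ht] at h; ring_nf at h; omega
  all_goals rw [ht] at h; ring_nf at h; omega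

theorem no_solution_seven_right (h : 7 * (49 * u ^ 2 - 8) * z ^ 2 = 8 * (Y ^ 2 + 98)) :
    False := by
  obtain ⟨Y, rfl⟩ | ⟨t, ht | ht | ht⟩ := Int.seven_dvd_or_sq Y
  · obtain ⟨z, rfl⟩ | ⟨t, ht | ht | ht⟩ := Int.seven_dvd_or_sq z
    · have h : 7 * (49 * u ^ 2 - 8) * z ^ 2 = 8 * (Y ^ 2 + 2) := by linarith
      obtain ⟨Y, rfl⟩ | ⟨t, ht | ht | ht⟩ := Int.seven_dvd_or_sq Y
      · ring_nf at h; omega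
      all_goals rw [ht] at h; ring_nf at h; omega
    all_goals rw [ht] at h; ring_nf at h; omega
  all_goals rw [ht] at h; ring_nf at h; omega

/-- The solutions of the equation for `Σ = m²`, `T = m² + 1`. -/
theorem solution_one (huv : u ^ 2 + 1 = 2 * v ^ 2)
    (h : (u ^ 2 - 8) * z ^ 2 = 8 * (Y ^ 2 + 2)) :
    ∃ y w : ℤ, (u ^ 2 - 8) * y ^ 2 = 1 + 8 * w ^ 2 := by
  obtain ⟨p, rfl⟩ | ⟨t, ht⟩ := Int.two_dvd_or_sq u
  · ring_nf at huv; omega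
  · rw [ht] at h ⊢
    obtain ⟨z, rfl⟩ | ⟨a, ha⟩ := Int.two_dvd_or_sq z
    · obtain ⟨z, rfl⟩ | ⟨a, ha⟩ := Int.two_dvd_or_sq z
      · have h : 2 * (8 * t - 7) * z ^ 2 = Y ^ 2 + 2 := by linarith
        obtain ⟨Y, rfl⟩ | ⟨b, hb⟩ := Int.two_dvd_or_sq Y
        · have h : (8 * t - 7) * z ^ 2 = 2 * Y ^ 2 + 1 := by linarith
          obtain ⟨z', rfl⟩ | ⟨a, ha⟩ := Int.two_dvd_or_sq z
          · ring_nf at h; omega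
          -- Now `z` is odd, so the left side is 1 modulo 8 and `Y` must be even; halving it once
          -- more produces the coefficient 8.
          · obtain ⟨Y, rfl⟩ | ⟨b, hb⟩ := Int.two_dvd_or_sq Y
            · exact ⟨z, Y, by linarith⟩
            · rw [ha, hb] at h; ring_nf at h; omega
        · rw [hb] at h; ring_nf at h; omega
      · have h : (8 * t - 7) * z ^ 2 = 2 * (Y ^ 2 + 2) := by linarith
        rw [ha] at h; ring_nf at h; omega
    · rw [ha] at h; ring_nf at h; omega

/-- The solutions of the equation for `Σ = 5m²`, `T = 5m² + 5`. -/
theorem solution_five (huv : u ^ 2 + 1 = 10 * v ^ 2)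
    (h : (5 * u ^ 2 - 8) * z ^ 2 = 8 * (Y ^ 2 + 10)) :
    ∃ y w : ℤ, (5 * u ^ 2 - 8) * y ^ 2 = 5 + 8 * w ^ 2 := by
  obtain ⟨p, rfl⟩ | ⟨t, ht⟩ := Int.two_dvd_or_sq u
  · ring_nf at huv; omega
  · rw [ht] at h ⊢
    obtain ⟨z, rfl⟩ | ⟨a, ha⟩ := Int.two_dvd_or_sq z
    · obtain ⟨z, rfl⟩ | ⟨a, ha⟩ := Int.two_dvd_or_sq z
      · have h : 2 * (40 * t - 3) * z ^ 2 = Y ^ 2 + 10 := by linarith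
        obtain ⟨Y, rfl⟩ | ⟨b, hb⟩ := Int.two_dvd_or_sq Y
        · have h : (40 * t - 3) * z ^ 2 = 2 * Y ^ 2 + 5 := by linarith
          obtain ⟨z', rfl⟩ | ⟨a, ha⟩ := Int.two_dvd_or_sq z
          · ring_nf at h; omega
          · obtain ⟨Y, rfl⟩ | ⟨b, hb⟩ := Int.two_dvd_or_sq Y
            · exact ⟨z, Y, by linarith⟩
            · rw [ha, hb] at h; ring_nf at h; omega
        · rw [hb] at h; ring_nf at h; omega
      · have h : (40 * t - 3) * z ^ 2 = 2 * (Y ^ 2 + 10) := by linarith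
        rw [ha] at h; ring_nf at h; omega
    · rw [ha] at h; ring_nf at h; omega

end FamilyExclusion

/-! ### The differences T - Σ from 1 to 8 -/

/-- The equation for `f` becomes `(puf)² = (qvy)²` after cancelling the common factor `g`. As `pu`
and `qv` are coprime, `y = puY`, and the factor `u²` cancels from the equation for `z`. What remains
is one conic-type condition on `(z, Y)`. -/
theorem Reduced.exists_of_eq {S k y z f α β g p q u v : ℕ} (R : Reduced S k y z f)
    (hS : S = α * u ^ 2) (hT : S + k = β * v ^ 2) (hα : 2 * α = g * p ^ 2)
    (hβ : k * β = g * q ^ 2) (hg : 0 < g) (hu : 0 < u) (hc : (p * u).Coprime (q * v)) :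
    ∃ Y : ℕ, (α : ℤ) * (α * u ^ 2 - 8) * z ^ 2 = 8 * k * p ^ 2 * (Y ^ 2 + g) := by
  have h1 : (p * u * f) ^ 2 = (q * v * y) ^ 2 := by
    have h := R.f_eq
    rw [hT, hS] at h
    refine Nat.eq_of_mul_eq_mul_left hg ?_
    calc g * (p * u * f) ^ 2 = g * p ^ 2 * (u * f) ^ 2 := by ring
      _ = 2 * (α * u ^ 2) * f ^ 2 := by rw [← hα]; ring
      _ = k * β * (v * y) ^ 2 := by rw [h]; ring
      _ = g * (q * v * y) ^ 2 := by rw [hβ]; ring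
  obtain ⟨Y, rfl⟩ := dvd_of_mul_sq_eq hc h1
  refine ⟨Y, ?_⟩
  have h := R.z_eq
  have hα' : (2 * α : ℤ) = g * p ^ 2 := by exact_mod_cast hα
  rw [hS] at h
  push_cast at h
  have hu' : (u : ℤ) ^ 2 ≠ 0 := by positivity
  apply mul_left_cancel₀ hu'
  linear_combination h + 8 * k * u ^ 2 * hα'

theorem coprime_two_mul {u v : ℕ} (h : u.Coprime v) (hv : ¬ 2 ∣ v) : (2 * u).Coprime v :=
  Nat.Coprime.mul_left ((Nat.prime_two.coprime_iff_not_dvd).2 hv) h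

theorem exists_of_two_mul_eq_sq {c A w : ℕ} (hc : Squarefree c) (hA : 0 < A)
    (h : c * A * (A + 1) = w ^ 2) :
    ∃ d₁ d₂ u v : ℕ, d₁ * d₂ = c ∧ A = d₁ * u ^ 2 ∧ A + 1 = d₂ * v ^ 2 ∧ u.Coprime v ∧
      0 < u ∧ 0 < v :=
  exists_eq_mul_sq_of_coprime hc (by simp) hA (by omega) h

theorem squarefree_two : Squarefree 2 := Nat.prime_two.prime.squarefree

theorem squarefree_mul_primes {p q : ℕ} (hp : p.Prime) (hq : q.Prime) (hpq : p ≠ q) :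
    Squarefree (p * q) :=
  (Nat.squarefree_mul ((Nat.coprime_primes hp hq).2 hpq)).2
    ⟨hp.prime.squarefree, hq.prime.squarefree⟩

theorem two_not_dvd_of_sq {v a : ℕ} (h : v ^ 2 = 2 * a + 1) : ¬ 2 ∣ v := by
  rintro ⟨r, rfl⟩
  ring_nf at h
  omega

/-- `2S(S + 1)` is a square with coprime `S` and `S + 1`, so the factor 2 goes to one of them. If it
goes to `S + 1`, this is the negative Pell family; if it goes to `S`, the equation for `z` has no
solution. -/
theorem Reduced.eq_one {S y z f w : ℕ} (R : Reduced S 1 y z f) (hS : 0 < S)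
    (h : 2 * S * 1 * (S + 1) = w ^ 2) :
    ∃ m n Y Z : ℤ, (S : ℤ) = m ^ 2 ∧ m ^ 2 - 2 * n ^ 2 = -1 ∧
      (m ^ 2 - 8) * Y ^ 2 = 1 + 8 * Z ^ 2 := by
  obtain ⟨d₁, d₂, u, v, hd, h1, h2, huv, hu, hv⟩ :=
    exists_of_two_mul_eq_sq squarefree_two hS (by rw [← h]; ring)
  have hle : d₁ ≤ 2 := Nat.le_of_dvd (by norm_num) ⟨d₂, hd.symm⟩
  interval_cases d₁
  · omega
  · obtain rfl : d₂ = 2 := by omega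
    obtain ⟨Y, hY⟩ := R.exists_of_eq (p := 1) (q := 1) (g := 2) h1 h2 rfl rfl two_pos hu
      (by simpa using huv)
    have e : (u : ℤ) ^ 2 + 1 = 2 * v ^ 2 := by norm_cast; omega
    obtain ⟨a, b, hab⟩ := solution_one e (z := z) (Y := Y) (by push_cast at hY; linarith)
    exact ⟨u, v, a, b, by rw [h1]; push_cast; ring, by linarith, hab⟩
  · obtain rfl : d₂ = 1 := by omega
    have e : v ^ 2 = 2 * u ^ 2 + 1 := by omega
    obtain ⟨Y, hY⟩ := R.exists_of_eq (p := 2) (q := 1) (g := 1) h1 h2 rfl rfl one_pos hu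
      (by simpa using coprime_two_mul huv (two_not_dvd_of_sq e))
    exact (no_solution_one (u := u) (v := v) (z := z) (Y := Y) (by exact_mod_cast e)
      (by push_cast at hY; linarith)).elim

/-- `4S(S + 2) = (2S + 2)² - 4` lies above `(2S)²`, so it could only be the odd square `(2S + 1)²`.
-/
theorem not_sq_two {S w : ℕ} (hS : 0 < S) (h : 2 * S * 2 * (S + 2) = w ^ 2) : False := by
  have h1 : w < 2 * S + 2 := by nlinarith
  have h2 : 2 * S < w := by nlinarith
  obtain rfl : w = 2 * S + 1 := by omega
  ring_nf at h
  omega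

theorem exists_eq_mul_of_sq {p a w : ℕ} (h : p * a = w ^ 2) (hp : p.Prime) :
    ∃ r, w = p * r ∧ a = p * r ^ 2 := by
  obtain ⟨r, rfl⟩ : p ∣ w := hp.dvd_of_dvd_pow ⟨a, h.symm⟩
  exact ⟨r, rfl, Nat.eq_of_mul_eq_mul_left hp.pos (by rw [h]; ring)⟩

/-- If `c p S (S + p)` is a square, then `p` divides `S`. -/
theorem exists_eq_prime_mul {p c S w : ℕ} (hp : p.Prime) (hc : c.Coprime p)
    (h : c * S * p * (S + p) = w ^ 2) :
    ∃ A w', S = p * A ∧ c * p * A * (A + 1) = w' ^ 2 := by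
  obtain ⟨r, rfl, hr⟩ := exists_eq_mul_of_sq (a := c * S * (S + p)) (by rw [← h]; ring) hp
  have hd : p ∣ c * S * (S + p) := ⟨_, hr⟩
  have hS : p ∣ S := by
    rcases (hp.dvd_mul).1 hd with h' | h'
    · rcases (hp.dvd_mul).1 h' with h'' | h''
      · exact absurd hc ((Nat.Prime.dvd_iff_not_coprime hp).1 h'' ∘ Nat.Coprime.symm)
      · exact h''
    · exact (Nat.dvd_add_left (dvd_refl p)).1 h'
  obtain ⟨A, rfl⟩ := hS
  refine ⟨A, r, rfl, ?_⟩
  have : p * (c * p * A * (A + 1)) = p * r ^ 2 := by rw [← hr]; ring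
  exact Nat.eq_of_mul_eq_mul_left hp.pos this

/-- Here `S = 3A`, and the factors of 6 are shared between `A` and `A + 1`. Two of the four
distributions fail modulo 3 at once; the other two need the equation for `z`. -/
theorem Reduced.ne_three {S y z f w : ℕ} (R : Reduced S 3 y z f) (hS : 0 < S)
    (h : 2 * S * 3 * (S + 3) = w ^ 2) : False := by
  obtain ⟨A, w', rfl, hA⟩ := exists_eq_prime_mul Nat.prime_three (by norm_num) h
  obtain ⟨d₁, d₂, u, v, hd, rfl, h2, huv, hu, hv⟩ :=
    exists_of_two_mul_eq_sq (squarefree_mul_primes Nat.prime_two Nat.prime_three (by norm_num))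
    (by omega) hA
  have hle : d₁ ≤ 6 := Nat.le_of_dvd (by norm_num) ⟨d₂, by omega⟩
  have key : (d₁ = 6 ∧ d₂ = 1) ∨ (d₁ = 2 ∧ d₂ = 3) ∨ (d₁ = 3 ∧ d₂ = 2) ∨ (d₁ = 1 ∧ d₂ = 6) := by
    interval_cases d₁ <;> omega
  rcases key with ⟨rfl, rfl⟩ | ⟨rfl, rfl⟩ | ⟨rfl, rfl⟩ | ⟨rfl, rfl⟩
  · have e : v ^ 2 = 2 * (3 * u ^ 2) + 1 := by omega
    obtain ⟨Y, hY⟩ := R.exists_of_eq (α := 18) (β := 3) (p := 2) (q := 1) (g := 9) (u := u)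
      (v := v) (by ring) (by omega) rfl rfl (by norm_num) hu
      (by simpa using coprime_two_mul huv (two_not_dvd_of_sq e))
    exact no_solution_three_left (u := u) (z := z) (Y := Y) (by push_cast at hY; linarith)
  · have e : 3 * v ^ 2 = 2 * u ^ 2 + 1 := by omega
    have h3 : ¬ 3 ∣ u := by rintro ⟨r, rfl⟩; ring_nf at e; omega
    have h2' : ¬ 2 ∣ 3 * v := by
      intro h'
      obtain ⟨r, rfl⟩ : 2 ∣ v := by omega
      ring_nf at e; omega
    obtain ⟨Y, hY⟩ := R.exists_of_eq (α := 6) (β := 9) (p := 2) (q := 3) (g := 3) (u := u)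
      (v := v) (by ring) (by omega) rfl rfl (by norm_num) hu
      (coprime_two_mul (Nat.Coprime.mul_right
        ((Nat.prime_three.coprime_iff_not_dvd).2 h3).symm huv) h2')
    exact no_solution_three_right (u := u) (v := v) (z := z) (Y := Y) (by exact_mod_cast e)
      (by push_cast at hY; linarith)
  · have e : (3 * u ^ 2 + 1 : ℤ) = 2 * v ^ 2 := by exact_mod_cast h2
    obtain ⟨t, ht⟩ | ⟨t, ht⟩ := Int.three_dvd_or_sq v
    · rw [ht] at e; ring_nf at e; omega
    · omega
  · have e : (u ^ 2 + 1 : ℤ) = 6 * v ^ 2 := by exact_mod_cast (by omega : u ^ 2 + 1 = 6 * v ^ 2)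
    obtain ⟨t, ht⟩ | ⟨t, ht⟩ := Int.three_dvd_or_sq u
    · rw [ht] at e; ring_nf at e; omega
    · omega

/-- Powers of 2 are stripped until `S` is four times some `A` with `2A(A + 1)` a square, which is
the splitting of the case `k = 1`. -/
theorem Reduced.ne_four {S y z f w : ℕ} (R : Reduced S 4 y z f) (hS : 0 < S)
    (h : 2 * S * 4 * (S + 4) = w ^ 2) : False := by
  obtain ⟨w₁, -, h₁⟩ := exists_eq_mul_of_sq (a := 4 * S * (S + 4)) (by rw [← h]; ring)
    Nat.prime_two
  obtain ⟨w₂, -, h₂⟩ := exists_eq_mul_of_sq (a := S * (S + 4)) (w := w₁) (by linarith)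
    Nat.prime_two
  obtain ⟨S, rfl⟩ : 2 ∣ S := by
    rcases (Nat.prime_two.dvd_mul).1 ⟨_, h₂⟩ with h' | h' <;> omega
  obtain ⟨w₃, -, h₃⟩ := exists_eq_mul_of_sq (a := S * (S + 2)) (w := w₂) (by linarith)
    Nat.prime_two
  obtain ⟨S, rfl⟩ : 2 ∣ S := by
    rcases (Nat.prime_two.dvd_mul).1 ⟨_, h₃⟩ with h' | h' <;> omega
  obtain ⟨d₁, d₂, u, v, hd, rfl, h2, huv, hu, hv⟩ :=
    exists_of_two_mul_eq_sq (c := 2) (A := S) (w := w₃) squarefree_two (by omega) (by linarith)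
  have hle : d₁ ≤ 2 := Nat.le_of_dvd (by norm_num) ⟨d₂, by omega⟩
  have key : (d₁ = 1 ∧ d₂ = 2) ∨ (d₁ = 2 ∧ d₂ = 1) := by
    interval_cases d₁ <;> omega
  rcases key with ⟨rfl, rfl⟩ | ⟨rfl, rfl⟩
  · have e : u ^ 2 + 1 = 2 * v ^ 2 := by omega
    have h2' : ¬ 2 ∣ u := by
      rintro ⟨r, rfl⟩
      ring_nf at e; omega
    obtain ⟨Y, hY⟩ := R.exists_of_eq (α := 4) (β := 8) (p := 1) (q := 2) (g := 8) (u := u)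
      (v := v) (by ring) (by omega) rfl rfl (by norm_num) hu
      (by simpa using (coprime_two_mul huv.symm h2').symm)
    exact no_solution_four_left (u := u) (v := v) (z := z) (Y := Y) (by exact_mod_cast e)
      (by push_cast at hY; linarith)
  · have e : v ^ 2 = 2 * u ^ 2 + 1 := by omega
    obtain ⟨Y, hY⟩ := R.exists_of_eq (α := 8) (β := 4) (p := 1) (q := 1) (g := 16) (u := u)
      (v := v) (by ring) (by omega) rfl rfl (by norm_num) hu (by simpa using huv)
    exact no_solution_four_right (u := u) (v := v) (z := z) (Y := Y) (by exact_mod_cast e)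
      (by push_cast at hY; linarith)

/-- Of the four distributions of 10 between `A = S/5` and `A + 1`, two need 2 or 3 to be a square
modulo 5 and one is excluded by the equation for `z`. The distribution `(1, 10)` is the family that
survives. -/
theorem Reduced.eq_five {S y z f w : ℕ} (R : Reduced S 5 y z f) (hS : 0 < S)
    (h : 2 * S * 5 * (S + 5) = w ^ 2) :
    ∃ m n Y Z : ℤ, (S : ℤ) = 5 * m ^ 2 ∧ m ^ 2 - 10 * n ^ 2 = -1 ∧
      (5 * m ^ 2 - 8) * Y ^ 2 = 5 + 8 * Z ^ 2 := by
  obtain ⟨A, w', rfl, hA⟩ := exists_eq_prime_mul Nat.prime_five (by norm_num) h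
  obtain ⟨d₁, d₂, u, v, hd, rfl, h2, huv, hu, hv⟩ :=
    exists_of_two_mul_eq_sq (squarefree_mul_primes Nat.prime_two Nat.prime_five (by norm_num))
    (by omega) hA
  have hle : d₁ ≤ 10 := Nat.le_of_dvd (by norm_num) ⟨d₂, by omega⟩
  have key : (d₁ = 10 ∧ d₂ = 1) ∨ (d₁ = 2 ∧ d₂ = 5) ∨ (d₁ = 5 ∧ d₂ = 2) ∨
      (d₁ = 1 ∧ d₂ = 10) := by
    interval_cases d₁ <;> omega
  rcases key with ⟨rfl, rfl⟩ | ⟨rfl, rfl⟩ | ⟨rfl, rfl⟩ | ⟨rfl, rfl⟩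
  · have e : v ^ 2 = 2 * (5 * u ^ 2) + 1 := by omega
    obtain ⟨Y, hY⟩ := R.exists_of_eq (α := 50) (β := 5) (p := 2) (q := 1) (g := 25) (u := u)
      (v := v) (by ring) (by omega) rfl rfl (by norm_num) hu
      (by simpa using coprime_two_mul huv (two_not_dvd_of_sq e))
    have e' : (v ^ 2 : ℤ) = 10 * u ^ 2 + 1 := by
      exact_mod_cast (by omega : v ^ 2 = 10 * u ^ 2 + 1)
    exact (no_solution_five (u := u) (z := z) (Y := Y) e' (by push_cast at hY; linarith)).elim
  · have e : (2 * u ^ 2 + 1 : ℤ) = 5 * v ^ 2 := by exact_mod_cast h2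
    obtain ⟨t, ht⟩ | ⟨t, ht | ht⟩ := Int.five_dvd_or_sq u
    · rw [ht] at e; ring_nf at e; omega
    · omega
    · omega
  · have e : (5 * u ^ 2 + 1 : ℤ) = 2 * v ^ 2 := by exact_mod_cast h2
    obtain ⟨t, ht⟩ | ⟨t, ht | ht⟩ := Int.five_dvd_or_sq v
    · rw [ht] at e; ring_nf at e; omega
    · omega
    · omega
  · have e : u ^ 2 + 1 = 10 * v ^ 2 := by omega
    have h5 : ¬ 5 ∣ u := by rintro ⟨r, rfl⟩; ring_nf at e; omega
    obtain ⟨Y, hY⟩ := R.exists_of_eq (α := 5) (β := 50) (p := 1) (q := 5) (g := 10) (u := u)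
      (v := v) (by ring) (by omega) rfl rfl (by norm_num) hu
      (Nat.Coprime.mul_right (by simpa using ((Nat.prime_five.coprime_iff_not_dvd).2 h5).symm)
        (by simpa using huv))
    have e' : (u ^ 2 + 1 : ℤ) = 10 * v ^ 2 := by exact_mod_cast e
    obtain ⟨a, b, hab⟩ := solution_five e' (z := z) (Y := Y) (by push_cast at hY; linarith)
    exact ⟨u, v, a, b, by push_cast; ring, by linarith, hab⟩

theorem Reduced.ne_six {S y z f w : ℕ} (R : Reduced S 6 y z f) (hS : 0 < S)
    (h : 2 * S * 6 * (S + 6) = w ^ 2) : False := by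
  obtain ⟨w₁, -, h₁⟩ := exists_eq_mul_of_sq (a := 6 * S * (S + 6)) (by rw [← h]; ring)
    Nat.prime_two
  obtain ⟨w₂, -, h₂⟩ := exists_eq_mul_of_sq (a := S * (S + 6)) (w := w₁) (by linarith)
    Nat.prime_three
  obtain ⟨S, rfl⟩ : 3 ∣ S := by
    rcases (Nat.prime_three.dvd_mul).1 ⟨_, h₂⟩ with h' | h' <;> omega
  obtain ⟨r, -, hr⟩ := exists_eq_mul_of_sq (a := S * (S + 2)) (w := w₂) (by linarith)
    Nat.prime_three
  -- The greatest common divisor of `S` and `S + 2` is 2 or 1; the even case is halved before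
  -- splitting.
  by_cases hodd : 2 ∣ S
  · obtain ⟨S, rfl⟩ := hodd
    obtain ⟨w, hw⟩ : 2 ∣ r := by
      have : 2 ∣ 3 * r ^ 2 := ⟨2 * (S * (S + 1)), by linarith⟩
      exact Nat.prime_two.dvd_of_dvd_pow
        ((Nat.prime_two.dvd_mul).1 this |>.resolve_left (by norm_num))
    subst hw
    obtain ⟨d₁, d₂, u, v, hd, rfl, h2, huv, hu, hv⟩ :=
      exists_of_two_mul_eq_sq (c := 3) (A := S) (w := 3 * w) Nat.prime_three.prime.squarefree
      (by omega) (by linarith)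
    have hle : d₁ ≤ 3 := Nat.le_of_dvd (by norm_num) ⟨d₂, by omega⟩
    have key : (d₁ = 1 ∧ d₂ = 3) ∨ (d₁ = 3 ∧ d₂ = 1) := by
      interval_cases d₁ <;> omega
    rcases key with ⟨rfl, rfl⟩ | ⟨rfl, rfl⟩
    · have e : (1 * u ^ 2 + 1 : ℤ) = 3 * v ^ 2 := by exact_mod_cast h2
      obtain ⟨t, ht⟩ | ⟨t, ht⟩ := Int.three_dvd_or_sq u
      · rw [ht] at e; ring_nf at e; omega
      · omega
    · obtain ⟨Y, hY⟩ := R.exists_of_eq (α := 18) (β := 6) (p := 1) (q := 1) (g := 36) (u := u)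
        (v := v) (by ring) (by omega) rfl rfl (by norm_num) hu (by simpa using huv)
      exact no_solution_six_right (u := u) (z := z) (Y := Y) (by push_cast at hY; linarith)
  · have hcop : S.Coprime (S + 2) := by
      simpa using ((Nat.prime_two.coprime_iff_not_dvd).2 hodd).symm
    obtain ⟨d₁, d₂, u, v, hd, rfl, h2, huv, hu, hv⟩ :=
      exists_eq_mul_sq_of_coprime (c := 3) (A := S) (w := 3 * r)
      Nat.prime_three.prime.squarefree hcop (by omega) (by omega) (by linarith)
    have hle : d₁ ≤ 3 := Nat.le_of_dvd (by norm_num) ⟨d₂, by omega⟩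
    have key : (d₁ = 1 ∧ d₂ = 3) ∨ (d₁ = 3 ∧ d₂ = 1) := by
      interval_cases d₁ <;> omega
    rcases key with ⟨rfl, rfl⟩ | ⟨rfl, rfl⟩
    · have e : u ^ 2 + 2 = 3 * v ^ 2 := by omega
      have h3 : ¬ 3 ∣ u := by rintro ⟨r, rfl⟩; ring_nf at e; omega
      have h2' : ¬ (2 : ℤ) ∣ u := by
        rintro ⟨r, hr⟩
        have : 2 ∣ u := by omega
        exact hodd (by simpa using dvd_pow this two_ne_zero)
      obtain ⟨Y, hY⟩ := R.exists_of_eq (α := 3) (β := 9) (p := 1) (q := 3) (g := 6) (u := u)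
        (v := v) (by ring) (by omega) rfl rfl (by norm_num) hu
        (Nat.Coprime.mul_right (by simpa using ((Nat.prime_three.coprime_iff_not_dvd).2 h3).symm)
          (by simpa using huv))
      exact no_solution_six_left (u := u) (v := v) (z := z) (Y := Y) (by exact_mod_cast e) h2'
        (by push_cast at hY; linarith)
    · have e : (3 * u ^ 2 + 2 : ℤ) = 1 * v ^ 2 := by exact_mod_cast h2
      obtain ⟨t, ht⟩ | ⟨t, ht⟩ := Int.three_dvd_or_sq v
      · rw [ht] at e; ring_nf at e; omega
      · omega

theorem Reduced.ne_seven {S y z f w : ℕ} (R : Reduced S 7 y z f) (hS : 0 < S)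
    (h : 2 * S * 7 * (S + 7) = w ^ 2) : False := by
  have hp : Nat.Prime 7 := by norm_num
  obtain ⟨A, w', rfl, hA⟩ := exists_eq_prime_mul hp (by norm_num) h
  obtain ⟨d₁, d₂, u, v, hd, rfl, h2, huv, hu, hv⟩ :=
    exists_of_two_mul_eq_sq (squarefree_mul_primes Nat.prime_two hp (by norm_num))
    (by omega) hA
  have hle : d₁ ≤ 14 := Nat.le_of_dvd (by norm_num) ⟨d₂, by omega⟩
  have key : (d₁ = 14 ∧ d₂ = 1) ∨ (d₁ = 2 ∧ d₂ = 7) ∨ (d₁ = 7 ∧ d₂ = 2) ∨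
      (d₁ = 1 ∧ d₂ = 14) := by
    interval_cases d₁ <;> omega
  rcases key with ⟨rfl, rfl⟩ | ⟨rfl, rfl⟩ | ⟨rfl, rfl⟩ | ⟨rfl, rfl⟩
  · have e : v ^ 2 = 2 * (7 * u ^ 2) + 1 := by omega
    obtain ⟨Y, hY⟩ := R.exists_of_eq (α := 98) (β := 7) (p := 2) (q := 1) (g := 49) (u := u)
      (v := v) (by ring) (by omega) rfl rfl (by norm_num) hu
      (by simpa using coprime_two_mul huv (two_not_dvd_of_sq e))
    exact no_solution_seven_left (u := u) (z := z) (Y := Y) (by push_cast at hY; linarith)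
  · have e : (2 * u ^ 2 + 1 : ℤ) = 7 * v ^ 2 := by exact_mod_cast h2
    obtain ⟨t, ht⟩ | ⟨t, ht | ht | ht⟩ := Int.seven_dvd_or_sq u
    · rw [ht] at e; ring_nf at e; omega
    all_goals omega
  · obtain ⟨Y, hY⟩ := R.exists_of_eq (α := 49) (β := 14) (p := 1) (q := 1) (g := 98) (u := u)
      (v := v) (by ring) (by omega) rfl rfl (by norm_num) hu (by simpa using huv)
    exact no_solution_seven_right (u := u) (z := z) (Y := Y) (by push_cast at hY; linarith)
  · have e : (1 * u ^ 2 + 1 : ℤ) = 14 * v ^ 2 := by exact_mod_cast h2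
    obtain ⟨t, ht⟩ | ⟨t, ht | ht | ht⟩ := Int.seven_dvd_or_sq u
    · rw [ht] at e; ring_nf at e; omega
    all_goals omega

/-- `S(S + 8)` lies strictly between `S²` and `(S + 4)²`. The bound on `S` excludes the one solution
`S = 1`, where the value is 9. -/
theorem not_sq_eight {S w : ℕ} (hS : 9 ≤ S) (h : 2 * S * 8 * (S + 8) = w ^ 2) : False := by
  obtain ⟨v, rfl⟩ : 4 ∣ w := by
    have : 4 ^ 2 ∣ w ^ 2 := ⟨S * (S + 8), by linarith⟩
    exact (Nat.pow_dvd_pow_iff two_ne_zero).1 this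
  have hv : S * (S + 8) = v ^ 2 := by linarith
  have h1 : v < S + 4 := by nlinarith
  have h2 : S < v := by nlinarith
  obtain ⟨i, rfl⟩ := Nat.exists_eq_add_of_lt h2
  have hi : i < 3 := by omega
  interval_cases i <;> ring_nf at hv <;> omega

/-! ### Assembly of the arithmetic classification -/

/-- Eliminating `x` leaves the equations of `Reduced`, a square condition on `2(s + 8)k(s + 8 + k)`,
and from `f < 2x` an upper bound on `y²`. The split at `k = 9` separates the finite search from the
Pell analysis. -/
theorem classification_nat {x y z s k f : ℕ} (hx : 0 < x) (hy : 0 < y) (hz : 0 < z)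
    (hs : 0 < s) (hk : 0 < k)
    (h1 : s * x ^ 2 = (s + 8 + k) * (y ^ 2 + 2 * (s + 8)))
    (h2 : (s + 8 + k) * (s + 8) * z ^ 2 = 8 * k * x ^ 2)
    (h3 : 4 * x * f = (s + 8 + k) * y * z) (hf : f < 2 * x)
    (hne : (s + 8) * k ≠ 8 * (s + 8 + k)) :
    (s = 1 ∧ k = 9) ∨ (s = 10 ∧ k = 32) ∨
      (k = 5 ∧ ∃ m n Y Z : ℤ, ((s + 8 : ℕ) : ℤ) = 5 * m ^ 2 ∧ m ^ 2 - 10 * n ^ 2 = -1 ∧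
        (5 * m ^ 2 - 8) * Y ^ 2 = 5 + 8 * Z ^ 2) ∨
      (k = 1 ∧ ∃ m n Y Z : ℤ, ((s + 8 : ℕ) : ℤ) = m ^ 2 ∧ m ^ 2 - 2 * n ^ 2 = -1 ∧
        (m ^ 2 - 8) * Y ^ 2 = 1 + 8 * Z ^ 2) := by
  have hT : 0 < s + 8 + k := by omega
  have hf_eq : 2 * (s + 8) * f ^ 2 = k * (s + 8 + k) * y ^ 2 := by
    have hpos : 0 < 8 * x ^ 2 := by positivity
    apply Nat.eq_of_mul_eq_mul_left hpos
    calc 8 * x ^ 2 * (2 * (s + 8) * f ^ 2) = (s + 8) * (4 * x * f) ^ 2 := by ring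
      _ = (s + 8 + k) * y ^ 2 * ((s + 8 + k) * (s + 8) * z ^ 2) := by rw [h3]; ring
      _ = _ := by rw [h2]; ring
  have hz_eq : z ^ 2 * (s + 8) * s = 8 * k * (y ^ 2 + 2 * (s + 8)) := by
    apply Nat.eq_of_mul_eq_mul_left hT
    calc (s + 8 + k) * (z ^ 2 * (s + 8) * s) = s * ((s + 8 + k) * (s + 8) * z ^ 2) := by ring
      _ = 8 * k * (s * x ^ 2) := by rw [h2]; ring
      _ = _ := by rw [h1]; ring
  have hyb : y ^ 2 * (s * k) < 8 * (s + 8) * (y ^ 2 + 2 * (s + 8)) := by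
    have hlt : k * (s + 8 + k) * y ^ 2 < 8 * (s + 8) * x ^ 2 := by
      rw [← hf_eq]
      have : f ^ 2 < (2 * x) ^ 2 := by gcongr
      nlinarith
    apply Nat.lt_of_mul_lt_mul_left (a := s + 8 + k)
    calc (s + 8 + k) * (y ^ 2 * (s * k)) = s * (k * (s + 8 + k) * y ^ 2) := by ring
      _ < s * (8 * (s + 8) * x ^ 2) := by gcongr
      _ = 8 * (s + 8) * (s * x ^ 2) := by ring
      _ = _ := by rw [h1]; ring
  obtain ⟨w, hw⟩ : ∃ w, 2 * (s + 8) * k * (s + 8 + k) = w ^ 2 := by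
    have h4 : z ^ 2 * (2 * (s + 8) * k * (s + 8 + k)) = (4 * k * x) ^ 2 := by
      calc z ^ 2 * (2 * (s + 8) * k * (s + 8 + k))
          = 2 * k * ((s + 8 + k) * (s + 8) * z ^ 2) := by ring
        _ = _ := by rw [h2]; ring
    obtain ⟨w, hw⟩ : z ∣ 4 * k * x := (Nat.pow_dvd_pow_iff two_ne_zero).1 ⟨_, h4.symm⟩
    refine ⟨w, Nat.eq_of_mul_eq_mul_left (pow_pos hz 2) ?_⟩
    rw [h4, hw]; ring
  have R : Reduced (s + 8) k y z f := by
    refine ⟨hf_eq, ?_⟩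
    zify at hz_eq
    push_cast
    linear_combination hz_eq
  have hS : 0 < s + 8 := by omega
  by_cases hk9 : 9 ≤ k
  · obtain ⟨j, rfl⟩ := Nat.exists_eq_add_of_le' hk9
    -- The search variable is `k - 8`, which is `j + 1` after the shift by 9. In these variables
    -- `S(T - S) = 8T` says that the product of `s` and `k - 8` is 64.
    have key := pair_of_equations (s := s) (j := j + 1) (x := x) (y := y) (z := z) hs (by omega) hy
      hz ⟨w, by rw [← sq, ← hw]; ring⟩ (by rw [h1]; ring) (by rw [hz_eq]) (by linarith)
      (fun h => hne (by linarith))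
    omega
  · interval_cases k
    · exact Or.inr (Or.inr (Or.inr ⟨rfl, R.eq_one hS hw⟩))
    · exact (not_sq_two hS hw).elim
    · exact (R.ne_three hS hw).elim
    · exact (R.ne_four hS hw).elim
    · exact Or.inr (Or.inr (Or.inl ⟨rfl, R.eq_five hS hw⟩))
    · exact (R.ne_six hS hw).elim
    · exact (R.ne_seven hS hw).elim
    · exact (not_sq_eight (by omega) hw).elim

/-- The arithmetic part: the possible values of `S = Σ` and `T`. -/
theorem classification {x y z S T f : ℤ} (hx : 0 < x) (hy : 0 < y) (hz : 0 < z)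
    (hS : 0 < S) (hT : 0 < T) (h1 : (S - 8) * x ^ 2 = T * (y ^ 2 + 2 * S))
    (h2 : T * S * z ^ 2 = 8 * (T - S) * x ^ 2) (h3 : 4 * x * f = T * y * z) (hf : f < 2 * x)
    (hne : S * (T - S) ≠ 8 * T) :
    (S = 9 ∧ T = 18) ∨ (S = 18 ∧ T = 50) ∨
      (∃ m n Y Z : ℤ, S = 5 * m ^ 2 ∧ T = 5 * m ^ 2 + 5 ∧
        m ^ 2 - 10 * n ^ 2 = -1 ∧ (5 * m ^ 2 - 8) * Y ^ 2 = 5 + 8 * Z ^ 2) ∨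
      (∃ m n Y Z : ℤ, S = m ^ 2 ∧ T = m ^ 2 + 1 ∧
        m ^ 2 - 2 * n ^ 2 = -1 ∧ (m ^ 2 - 8) * Y ^ 2 = 1 + 8 * Z ^ 2) := by
  have hs : 0 < S - 8 := by
    have : 0 < (S - 8) * x ^ 2 := by rw [h1]; positivity
    exact pos_of_mul_pos_left this (by positivity)
  have hk : 0 < T - S := by
    have : 0 < (T - S) * (8 * x ^ 2) := by
      rw [show (T - S) * (8 * x ^ 2) = 8 * (T - S) * x ^ 2 by ring, ← h2]; positivity
    exact pos_of_mul_pos_left this (by positivity)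
  have hf0 : 0 < f := by
    have : 0 < f * (4 * x) := by rw [show f * (4 * x) = 4 * x * f by ring, h3]; positivity
    exact pos_of_mul_pos_left this (by positivity)
  obtain ⟨s, rfl⟩ : ∃ s : ℕ, S = s + 8 := ⟨(S - 8).toNat, by omega⟩
  obtain ⟨k, rfl⟩ : ∃ k : ℕ, T = s + 8 + k := ⟨(T - (s + 8)).toNat, by omega⟩
  lift x to ℕ using hx.le
  lift y to ℕ using hy.le
  lift z to ℕ using hz.le
  lift f to ℕ using hf0.le
  have key := classification_nat (x := x) (y := y) (z := z) (s := s) (k := k) (f := f)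
    (by omega) (by omega) (by omega) (by omega) (by omega)
    (by zify; linarith) (by zify; linarith) (by exact_mod_cast h3) (by omega)
    (fun h => hne (by zify at h; linarith))
  rcases key with ⟨rfl, rfl⟩ | ⟨rfl, rfl⟩ | ⟨rfl, m, n, Y, Z, h, h', h''⟩ |
    ⟨rfl, m, n, Y, Z, h, h', h''⟩
  · left; norm_num
  · right; left; norm_num
  · right; right; left
    push_cast at h ⊢
    exact ⟨m, n, Y, Z, h, by rw [h], h', h''⟩
  · right; right; right
    push_cast at h ⊢
    exact ⟨m, n, Y, Z, h, by rw [h], h', h''⟩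

/-! ### The excircle: orientation, tangent lengths and order of the sides -/

/-- Coordinates, relative to the vertex `O`, of the vertices `A`, `B`, `C` of a quadrilateral and
of the center `i` and the radius `r` of a circle that touches the lines `OA`, `AB`, `CB`, `OC` in
the points with parameters `u`, `s`, `w`, `v` and lies outside `B`. -/
structure TangentConfig (a₁ a₂ b₁ b₂ c₁ c₂ i₁ i₂ r u s w v : ℝ) : Prop where
  r_pos : 0 < r
  orth_OA : (u * a₁ - i₁) * a₁ + (u * a₂ - i₂) * a₂ = 0
  norm_OA : (u * a₁ - i₁) ^ 2 + (u * a₂ - i₂) ^ 2 = r ^ 2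
  orth_AB : (a₁ + s * (b₁ - a₁) - i₁) * (b₁ - a₁) + (a₂ + s * (b₂ - a₂) - i₂) * (b₂ - a₂) = 0
  norm_AB : (a₁ + s * (b₁ - a₁) - i₁) ^ 2 + (a₂ + s * (b₂ - a₂) - i₂) ^ 2 = r ^ 2
  orth_CB : (c₁ + w * (b₁ - c₁) - i₁) * (b₁ - c₁) + (c₂ + w * (b₂ - c₂) - i₂) * (b₂ - c₂) = 0
  norm_CB : (c₁ + w * (b₁ - c₁) - i₁) ^ 2 + (c₂ + w * (b₂ - c₂) - i₂) ^ 2 = r ^ 2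
  orth_OC : (v * c₁ - i₁) * c₁ + (v * c₂ - i₂) * c₂ = 0
  norm_OC : (v * c₁ - i₁) ^ 2 + (v * c₂ - i₂) ^ 2 = r ^ 2
  sep_AB : (a₁ * b₂ - a₂ * b₁) * ((b₁ - a₁) * (i₂ - a₂) - (b₂ - a₂) * (i₁ - a₁)) < 0
  sep_BC : (b₁ * c₂ - b₂ * c₁) * ((c₁ - b₁) * (i₂ - b₂) - (c₂ - b₂) * (i₁ - b₁)) < 0
  ne_COA : a₁ * c₂ - a₂ * c₁ ≠ 0
  ne_ABC : (b₁ - a₁) * (c₂ - a₂) - (b₂ - a₂) * (c₁ - a₁) ≠ 0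
  not_cross_OA_BC : ¬ ((a₁ * b₂ - a₂ * b₁) * (a₁ * c₂ - a₂ * c₁) < 0 ∧
    (b₁ * c₂ - b₂ * c₁) * ((b₁ - a₁) * (c₂ - a₂) - (b₂ - a₂) * (c₁ - a₁)) < 0)
  not_cross_AB_CO : ¬ ((a₁ * b₂ - a₂ * b₁) *
    ((b₁ - a₁) * (c₂ - a₂) - (b₂ - a₂) * (c₁ - a₁)) < 0 ∧
    (a₁ * c₂ - a₂ * c₁) * (b₁ * c₂ - b₂ * c₁) < 0)

/-- A circle stays on one side of its tangent. With `d` orthogonal to the radius `e`, `|d × e| = |d|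
r`, while `|d × h| ≤ |d| r` for every other radius `h`. -/
theorem side_nonpos {d₁ d₂ e₁ e₂ h₁ h₂ r : ℝ} (ho : d₁ * e₁ + d₂ * e₂ = 0)
    (he : e₁ ^ 2 + e₂ ^ 2 = r ^ 2) (hh : h₁ ^ 2 + h₂ ^ 2 = r ^ 2)
    (hneg : d₁ * e₂ - d₂ * e₁ < 0) :
    d₁ * h₂ - d₂ * h₁ + (d₁ * e₂ - d₂ * e₁) ≤ 0 := by
  have h1 : (d₁ * e₂ - d₂ * e₁) ^ 2 = (d₁ ^ 2 + d₂ ^ 2) * r ^ 2 := by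
    rw [← he]; linear_combination (-(d₁ * e₁ + d₂ * e₂)) * ho
  have h2 : (d₁ * h₂ - d₂ * h₁) ^ 2 ≤ (d₁ * e₂ - d₂ * e₁) ^ 2 := by
    rw [h1, ← hh]; nlinarith [sq_nonneg (d₁ * h₁ + d₂ * h₂)]
  have := sq_le_sq.1 h2
  rw [abs_of_neg hneg] at this
  linarith [le_abs_self (d₁ * h₂ - d₂ * h₁)]

/-- The possible signs, given the positions of the points of contact. -/
theorem signs_of_contact {N M D E u s w gO gC : ℝ} (hsum : D + E = N + M) (hN : 0 < N)
    (hM0 : M ≠ 0) (hD0 : D ≠ 0) (hE0 : E ≠ 0) (hX1 : ¬ (N * D < 0 ∧ M * E < 0))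
    (hX2 : ¬ (N * E < 0 ∧ D * M < 0)) (hu : 1 ≤ u) (hQ : M * ((1 - u) * M + u * E) ≤ 0)
    (hP : M * ((1 - s) * E) ≤ 0) (hP' : (1 - w) * E ≤ 0) (hDO : 0 < D * gO) (hDC : 0 < D * gC)
    (hsO : 0 ≤ gO * (s * N)) (hwC : 0 ≤ gC * (w * M)) :
    0 < M ∧ 0 < D ∧ 0 ≤ s ∧ 0 ≤ w ∧ ((s ≤ 1 ∧ w ≤ 1) ∨ (1 ≤ s ∧ 1 ≤ w)) := by
  -- If `M < 0`, mixed signs of `D` and `E` make two opposite sides cross. Equal signs put a point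
  -- of contact on the wrong side of a tangent: that of `AB` with respect to `OA`, or that of `BC`
  -- with respect to `CO`.
  have hMpos : 0 < M := by
    by_contra hcon
    have hM : M < 0 := lt_of_le_of_ne (not_lt.1 hcon) hM0
    rcases lt_or_gt_of_ne hD0 with hD | hD
    · have hgO : gO < 0 := neg_of_mul_pos_right hDO hD.le
      rcases lt_or_gt_of_ne hE0 with hE | hE
      · have h1 : 0 ≤ (1 - s) * E := nonneg_of_mul_nonpos_right hP hM
        have h2 : 1 - s ≤ 0 := nonpos_of_mul_nonneg_left h1 hE
        exact absurd hsO (not_le.2 (mul_neg_of_neg_of_pos hgO (mul_pos (by linarith) hN)))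
      · exact hX1 ⟨mul_neg_of_pos_of_neg hN hD, mul_neg_of_neg_of_pos hM hE⟩
    · have hgC : 0 < gC := pos_of_mul_pos_right hDC hD.le
      rcases lt_or_gt_of_ne hE0 with hE | hE
      · exact hX2 ⟨mul_neg_of_pos_of_neg hN hE, mul_neg_of_pos_of_neg hD hM⟩
      · have h2 : 1 - w ≤ 0 := nonpos_of_mul_nonpos_left hP' hE
        exact absurd hwC (not_le.2 (mul_neg_of_pos_of_neg hgC
          (mul_neg_of_pos_of_neg (by linarith) hM)))
  have hDpos : 0 < D := by
    by_contra hcon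
    have hD : D < 0 := lt_of_le_of_ne (not_lt.1 hcon) hD0
    have h1 : (1 - u) * M + u * E ≤ 0 := nonpos_of_mul_nonpos_right hQ hMpos
    have h2 : 0 < u * (E - M) := mul_pos (by linarith) (by linarith)
    linarith
  have hgOpos : 0 < gO := pos_of_mul_pos_right hDO hDpos.le
  have hgCpos : 0 < gC := pos_of_mul_pos_right hDC hDpos.le
  refine ⟨hMpos, hDpos, nonneg_of_mul_nonneg_left (nonneg_of_mul_nonneg_right hsO hgOpos) hN,
    nonneg_of_mul_nonneg_left (nonneg_of_mul_nonneg_right hwC hgCpos) hMpos, ?_⟩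
  have hP : (1 - s) * E ≤ 0 := nonpos_of_mul_nonpos_right hP hMpos
  rcases lt_or_gt_of_ne hE0 with hE | hE
  · left
    exact ⟨by linarith [nonneg_of_mul_nonpos_left hP hE],
      by linarith [nonneg_of_mul_nonpos_left hP' hE]⟩
  · right
    exact ⟨by linarith [nonpos_of_mul_nonpos_left hP hE],
      by linarith [nonpos_of_mul_nonpos_left hP' hE]⟩

namespace TangentConfig

variable {a₁ a₂ b₁ b₂ c₁ c₂ i₁ i₂ r u s w v : ℝ}

/-- Exchanging the coordinates is a reflection: it changes the sign of each determinant, while the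
orientation conditions involve products of two or non-vanishing. This allows `OAB` to be taken
positively oriented. -/
theorem swap (h : TangentConfig a₁ a₂ b₁ b₂ c₁ c₂ i₁ i₂ r u s w v) :
    TangentConfig a₂ a₁ b₂ b₁ c₂ c₁ i₂ i₁ r u s w v where
  r_pos := h.r_pos
  orth_OA := by linarith [h.orth_OA]
  norm_OA := by linarith [h.norm_OA]
  orth_AB := by linarith [h.orth_AB]
  norm_AB := by linarith [h.norm_AB]
  orth_CB := by linarith [h.orth_CB]
  norm_CB := by linarith [h.norm_CB]
  orth_OC := by linarith [h.orth_OC]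
  norm_OC := by linarith [h.norm_OC]
  sep_AB := by linarith [h.sep_AB]
  sep_BC := by linarith [h.sep_BC]
  ne_COA := fun h' => h.ne_COA (by linarith)
  ne_ABC := fun h' => h.ne_ABC (by linarith)
  not_cross_OA_BC := fun h' => h.not_cross_OA_BC ⟨by linarith [h'.1], by linarith [h'.2]⟩
  not_cross_AB_CO := fun h' => h.not_cross_AB_CO ⟨by linarith [h'.1], by linarith [h'.2]⟩

/-- For a positively oriented triangle `OAB`, the shape of the quadrilateral and the length
relations that the circle forces. -/
theorem shape (h : TangentConfig a₁ a₂ b₁ b₂ c₁ c₂ i₁ i₂ r u s w v)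
    (hN : 0 < a₁ * b₂ - a₂ * b₁) {a b c d : ℝ} (ha : 0 < a) (hb : 0 < b) (hc : 0 < c)
    (hd : 0 < d) (ha2 : a ^ 2 = a₁ ^ 2 + a₂ ^ 2) (hb2 : b ^ 2 = (b₁ - a₁) ^ 2 + (b₂ - a₂) ^ 2)
    (hc2 : c ^ 2 = (b₁ - c₁) ^ 2 + (b₂ - c₂) ^ 2) (hd2 : d ^ 2 = c₁ ^ 2 + c₂ ^ 2) :
    0 < b₁ * c₂ - b₂ * c₁ ∧ 0 < a₁ * c₂ - a₂ * c₁ ∧ a + b = c + d ∧ c < a := by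
  obtain ⟨N, hNe⟩ : ∃ N, N = a₁ * b₂ - a₂ * b₁ := ⟨_, rfl⟩
  obtain ⟨M, hMe⟩ : ∃ M, M = b₁ * c₂ - b₂ * c₁ := ⟨_, rfl⟩
  obtain ⟨D, hDe⟩ : ∃ D, D = a₁ * c₂ - a₂ * c₁ := ⟨_, rfl⟩
  obtain ⟨E, hEe⟩ : ∃ E, E = (b₁ - a₁) * (c₂ - a₂) - (b₂ - a₂) * (c₁ - a₁) := ⟨_, rfl⟩
  have hsum : D + E = N + M := by rw [hNe, hMe, hDe, hEe]; ring
  have hD0 : D ≠ 0 := hDe ▸ h.ne_COA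
  have hE0 : E ≠ 0 := hEe ▸ h.ne_ABC
  have hX1 : ¬ (N * D < 0 ∧ M * E < 0) := by
    rw [hNe, hMe, hDe, hEe]; exact h.not_cross_OA_BC
  have hX2 : ¬ (N * E < 0 ∧ D * M < 0) := by
    rw [hNe, hMe, hDe, hEe]; exact h.not_cross_AB_CO
  rw [← hNe] at hN
  rw [← hMe, ← hDe]
  obtain ⟨gA, hgA⟩ : ∃ g, g = (b₁ - a₁) * (i₂ - a₂) - (b₂ - a₂) * (i₁ - a₁) := ⟨_, rfl⟩
  obtain ⟨gB, hgB⟩ : ∃ g, g = (c₁ - b₁) * (i₂ - b₂) - (c₂ - b₂) * (i₁ - b₁) := ⟨_, rfl⟩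
  obtain ⟨gO, hgO⟩ : ∃ g, g = a₁ * i₂ - a₂ * i₁ := ⟨_, rfl⟩
  obtain ⟨gC, hgC⟩ : ∃ g, g = i₁ * c₂ - i₂ * c₁ := ⟨_, rfl⟩
  -- The quadrilateral is the signed sum of the four triangles that join its sides to the centre of
  -- the circle.
  have hgsum : gO + gA + gB + gC = N + M := by rw [hNe, hMe, hgA, hgB, hgO, hgC]; ring
  have hsA : N * gA < 0 := by rw [hNe, hgA]; exact h.sep_AB
  have hsB : M * gB < 0 := by rw [hMe, hgB]; exact h.sep_BC
  have hgA0 : gA < 0 := by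
    rcases mul_neg_iff.1 hsA with h' | h'
    · exact h'.2
    · linarith [h'.1]
  -- squares of the signed distances
  have qA : gA ^ 2 = (r * b) ^ 2 := by
    rw [mul_pow, hb2, ← h.norm_AB, hgA]
    linear_combination (-((a₁ + s * (b₁ - a₁) - i₁) * (b₁ - a₁) +
      (a₂ + s * (b₂ - a₂) - i₂) * (b₂ - a₂))) * h.orth_AB
  have qB : gB ^ 2 = (r * c) ^ 2 := by
    rw [mul_pow, hc2, ← h.norm_CB, hgB]
    linear_combination (-((c₁ + w * (b₁ - c₁) - i₁) * (b₁ - c₁) +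
      (c₂ + w * (b₂ - c₂) - i₂) * (b₂ - c₂))) * h.orth_CB
  have qO : gO ^ 2 = (r * a) ^ 2 := by
    rw [mul_pow, ha2, ← h.norm_OA, hgO]
    linear_combination (-((u * a₁ - i₁) * a₁ + (u * a₂ - i₂) * a₂)) * h.orth_OA
  have qC : gC ^ 2 = (r * d) ^ 2 := by
    rw [mul_pow, hd2, ← h.norm_OC, hgC]
    linear_combination (-((v * c₁ - i₁) * c₁ + (v * c₂ - i₂) * c₂)) * h.orth_OC
  have side_AB : ∀ x₁ x₂ : ℝ, (x₁ - i₁) ^ 2 + (x₂ - i₂) ^ 2 = r ^ 2 →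
      (b₁ - a₁) * (x₂ - a₂) - (b₂ - a₂) * (x₁ - a₁) ≤ 0 := by
    intro x₁ x₂ hx
    have := side_nonpos (d₁ := b₁ - a₁) (d₂ := b₂ - a₂)
      (e₁ := -(a₁ + s * (b₁ - a₁) - i₁)) (e₂ := -(a₂ + s * (b₂ - a₂) - i₂))
      (by linarith [h.orth_AB]) (by linarith [h.norm_AB]) hx (by linarith)
    linarith
  have side_BC : ∀ x₁ x₂ : ℝ, (x₁ - i₁) ^ 2 + (x₂ - i₂) ^ 2 = r ^ 2 →
      M * ((c₁ - b₁) * (x₂ - b₂) - (c₂ - b₂) * (x₁ - b₁)) ≤ 0 := by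
    intro x₁ x₂ hx
    rcases mul_neg_iff.1 hsB with ⟨h1, h2⟩ | ⟨h1, h2⟩
    · have := side_nonpos (d₁ := c₁ - b₁) (d₂ := c₂ - b₂)
        (e₁ := -(c₁ + w * (b₁ - c₁) - i₁)) (e₂ := -(c₂ + w * (b₂ - c₂) - i₂))
        (by linarith [h.orth_CB]) (by linarith [h.norm_CB]) hx (by linarith)
      exact mul_nonpos_of_nonneg_of_nonpos h1.le (by linarith)
    · have := side_nonpos (d₁ := b₁ - c₁) (d₂ := b₂ - c₂)
        (e₁ := -(c₁ + w * (b₁ - c₁) - i₁)) (e₂ := -(c₂ + w * (b₂ - c₂) - i₂))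
        (by linarith [h.orth_CB]) (by linarith [h.norm_CB]) hx (by linarith)
      exact mul_nonpos_of_nonpos_of_nonneg h1.le (by linarith)
  have side_OA : ∀ x₁ x₂ : ℝ, (x₁ - i₁) ^ 2 + (x₂ - i₂) ^ 2 = r ^ 2 →
      0 ≤ gO * (a₁ * x₂ - a₂ * x₁) := by
    intro x₁ x₂ hx
    rcases lt_trichotomy gO 0 with hg | hg | hg
    · have := side_nonpos (d₁ := a₁) (d₂ := a₂) (e₁ := -(u * a₁ - i₁)) (e₂ := -(u * a₂ - i₂))
        (by linarith [h.orth_OA]) (by linarith [h.norm_OA]) hx (by linarith)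
      exact mul_nonneg_of_nonpos_of_nonpos hg.le (by linarith)
    · rw [hg, zero_mul]
    · have := side_nonpos (d₁ := -a₁) (d₂ := -a₂) (e₁ := -(u * a₁ - i₁)) (e₂ := -(u * a₂ - i₂))
        (by linarith [h.orth_OA]) (by linarith [h.norm_OA]) hx (by linarith)
      exact mul_nonneg hg.le (by linarith)
  have side_CO : ∀ x₁ x₂ : ℝ, (x₁ - i₁) ^ 2 + (x₂ - i₂) ^ 2 = r ^ 2 →
      0 ≤ gC * (x₁ * c₂ - x₂ * c₁) := by
    intro x₁ x₂ hx
    rcases lt_trichotomy gC 0 with hg | hg | hg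
    · have := side_nonpos (d₁ := -c₁) (d₂ := -c₂) (e₁ := -(v * c₁ - i₁)) (e₂ := -(v * c₂ - i₂))
        (by linarith [h.orth_OC]) (by linarith [h.norm_OC]) hx (by linarith)
      exact mul_nonneg_of_nonpos_of_nonpos hg.le (by linarith)
    · rw [hg, zero_mul]
    · have := side_nonpos (d₁ := c₁) (d₂ := c₂) (e₁ := -(v * c₁ - i₁)) (e₂ := -(v * c₂ - i₂))
        (by linarith [h.orth_OC]) (by linarith [h.norm_OC]) hx (by linarith)
      exact mul_nonneg hg.le (by linarith)
  have hgO0 : gO ≠ 0 := by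
    rintro h0
    rw [h0] at qO
    have : 0 < (r * a) ^ 2 := by have := h.r_pos; positivity
    linarith
  have hgC0 : gC ≠ 0 := by
    rintro h0
    rw [h0] at qC
    have : 0 < (r * d) ^ 2 := by have := h.r_pos; positivity
    linarith
  -- positions of the four points of contact
  have hM0 : M ≠ 0 := by rintro h0; rw [h0, zero_mul] at hsB; exact lt_irrefl _ hsB
  -- The circle and `O` are on opposite sides of `AB`, so the contact point on `OA` is not before
  -- `A`. Likewise `v ≥ 1` on `OC`.
  have hu : 1 ≤ u := by
    have := side_AB _ _ h.norm_OA
    have h1 : (1 - u) * N ≤ 0 := by rw [hNe]; linarith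
    linarith [nonpos_of_mul_nonpos_left h1 hN]
  have hv : 1 ≤ v := by
    have := side_BC _ _ h.norm_OC
    have h1 : (1 - v) * (M * M) ≤ 0 := by
      have e : M * ((c₁ - b₁) * (v * c₂ - b₂) - (c₂ - b₂) * (v * c₁ - b₁)) = (1 - v) * (M * M) := by
        rw [hMe]; ring
      rw [← e]; exact this
    linarith [nonpos_of_mul_nonpos_left h1 (mul_self_pos.2 hM0)]
  have hQ : M * ((1 - u) * M + u * E) ≤ 0 := by
    have := side_BC _ _ h.norm_OA
    have e : M * ((c₁ - b₁) * (u * a₂ - b₂) - (c₂ - b₂) * (u * a₁ - b₁)) =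
        M * ((1 - u) * M + u * E) := by rw [hMe, hEe]; ring
    rw [← e]; exact this
  have hP : M * ((1 - s) * E) ≤ 0 := by
    have := side_BC _ _ h.norm_AB
    have e : M * ((c₁ - b₁) * (a₂ + s * (b₂ - a₂) - b₂) - (c₂ - b₂) * (a₁ + s * (b₁ - a₁) - b₁)) =
        M * ((1 - s) * E) := by rw [hMe, hEe]; ring
    rw [← e]; exact this
  have hP' : (1 - w) * E ≤ 0 := by
    have := side_AB _ _ h.norm_CB
    rw [hEe]
    linarith
  have hDC : 0 < D * gC := by
    have h1 := side_CO _ _ h.norm_OA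
    have e : gC * (u * a₁ * c₂ - u * a₂ * c₁) = u * (D * gC) := by rw [hDe]; ring
    have h2 : D * gC ≠ 0 := mul_ne_zero hD0 hgC0
    rw [e] at h1
    exact lt_of_le_of_ne (nonneg_of_mul_nonneg_right h1 (by linarith)) h2.symm
  have hDO : 0 < D * gO := by
    have h1 := side_OA _ _ h.norm_OC
    have e : gO * (a₁ * (v * c₂) - a₂ * (v * c₁)) = v * (D * gO) := by rw [hDe]; ring
    have h2 : D * gO ≠ 0 := mul_ne_zero hD0 hgO0
    rw [e] at h1
    exact lt_of_le_of_ne (nonneg_of_mul_nonneg_right h1 (by linarith)) h2.symm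
  have hsO : 0 ≤ gO * (s * N) := by
    have h1 := side_OA _ _ h.norm_AB
    have e : gO * (a₁ * (a₂ + s * (b₂ - a₂)) - a₂ * (a₁ + s * (b₁ - a₁))) = gO * (s * N) := by
      rw [hNe]; ring
    rw [← e]; exact h1
  have hwC : 0 ≤ gC * (w * M) := by
    have h1 := side_CO _ _ h.norm_CB
    have e : gC * ((c₁ + w * (b₁ - c₁)) * c₂ - (c₂ + w * (b₂ - c₂)) * c₁) = gC * (w * M) := by
      rw [hMe]; ring
    rw [← e]; exact h1
  obtain ⟨hMpos, hDpos, hs0, hw0, hsw⟩ := signs_of_contact hsum hN hM0 hD0 hE0 hX1 hX2 hu hQ hP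
    hP' hDO hDC hsO hwC
  have hgOpos : 0 < gO := pos_of_mul_pos_right hDO hDpos.le
  have hgCpos : 0 < gC := pos_of_mul_pos_right hDC hDpos.le
  have hgB0 : gB < 0 := neg_of_mul_neg_right hsB hMpos.le
  -- lengths of the tangent segments
  have t1 : u * a = v * d := by
    have : (u * a) ^ 2 = (v * d) ^ 2 := by
      rw [mul_pow, mul_pow, ha2, hd2]
      linear_combination 2 * u * h.orth_OA - h.norm_OA - 2 * v * h.orth_OC + h.norm_OC
    exact (sq_eq_sq₀ (mul_nonneg (by linarith) ha.le) (mul_nonneg (by linarith) hd.le)).1 this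
  have t2 : (u - 1) * a = s * b := by
    have : ((u - 1) * a) ^ 2 = (s * b) ^ 2 := by
      rw [mul_pow, mul_pow, ha2, hb2]
      linear_combination 2 * (u - 1) * h.orth_OA - h.norm_OA - 2 * s * h.orth_AB + h.norm_AB
    exact (sq_eq_sq₀ (mul_nonneg (by linarith) ha.le) (mul_nonneg hs0 hb.le)).1 this
  have t3 : (v - 1) * d = w * c := by
    have : ((v - 1) * d) ^ 2 = (w * c) ^ 2 := by
      rw [mul_pow, mul_pow, hd2, hc2]
      linear_combination 2 * (v - 1) * h.orth_OC - h.norm_OC - 2 * w * h.orth_CB + h.norm_CB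
    exact (sq_eq_sq₀ (mul_nonneg (by linarith) hd.le) (mul_nonneg hw0 hc.le)).1 this
  -- The two tangents from `B` have equal length. The signs of `1 - s` and `1 - w` agree because
  -- both contacts lie before `B` or both beyond it.
  have t4 : (1 - s) * b = (1 - w) * c := by
    have h1 : ((1 - s) * b) ^ 2 = ((1 - w) * c) ^ 2 := by
      rw [mul_pow, mul_pow, hb2, hc2]
      linear_combination -2 * (1 - s) * h.orth_AB - h.norm_AB + 2 * (1 - w) * h.orth_CB + h.norm_CB
    rcases hsw with ⟨h2, h3⟩ | ⟨h2, h3⟩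
    · exact (sq_eq_sq₀ (mul_nonneg (by linarith) hb.le) (mul_nonneg (by linarith) hc.le)).1 h1
    · have : (s - 1) * b = (w - 1) * c :=
        (sq_eq_sq₀ (mul_nonneg (by linarith) hb.le) (mul_nonneg (by linarith) hc.le)).1
          (by linarith)
      linarith
  have habcd : a + b = c + d := by linarith
  refine ⟨hMpos, hDpos, habcd, ?_⟩
  have hr := h.r_pos
  have e1 : gO = r * a := (sq_eq_sq₀ hgOpos.le (by positivity)).1 qO
  have e2 : gC = r * d := (sq_eq_sq₀ hgCpos.le (by positivity)).1 qC
  have e3 : -gA = r * b := (sq_eq_sq₀ (by linarith) (by positivity)).1 (by linarith)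
  have e4 : -gB = r * c := (sq_eq_sq₀ (by linarith) (by positivity)).1 (by linarith)
  -- The four triangles at the centre have height `r`, and those on `AB` and `BC` count negatively,
  -- so the positive `N + M` equals `r(a + d - b - c)`, which is `2r(a - c)`.
  have : 0 < r * (a + d - b - c) := by linarith
  have := pos_of_mul_pos_right this hr.le
  linarith

end TangentConfig

/-! ### Relations between sides, areas, Σ and T -/

/-- The scalar relations between the side lengths `a`, `b`, `c`, `d`, the doubled signed areas
`N`, `M`, `D`, `E` of `OAB`, `OBC`, `OAC`, `ABC`, and the two quantities `S` and `T`. -/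
structure AreaRelations (a b c d N M D E S T : ℝ) : Prop where
  sum_pos : 0 < a + b
  add_eq : a + b = c + d
  area_OB : N + M = 4 * (a + b)
  area_AC : D + E = 4 * (a + b)
  S_pos : 0 < S
  T_pos : 0 < T
  D_sq : D ^ 2 = S * (2 * (a * d) - S)
  E_sq : E ^ 2 = S * (2 * (b * c) - S)
  N_sq : N ^ 2 = T * (2 * (a * b) - T)
  M_sq : M ^ 2 = T * (2 * (c * d) - T)
  diag : ((a + b) ^ 2 - 2 * T) * ((a - d) ^ 2 + 2 * S) = (a + b) ^ 2 * (16 + (a - d) ^ 2)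
  D_ne : D ≠ 0
  E_ne : E ≠ 0

namespace AreaRelations

variable {a b c d N M D E S T : ℝ}

/-- `D² - E² = 2S(ad - bc)` is divided by `D + E`, with `ad - bc = (a + b)(a - c)`. In the next
lemma the analogue is `cd - ab = (a - c)(a - d)`. -/
theorem sub_D_E (h : AreaRelations a b c d N M D E S T) : D - E = S * (a - c) / 2 := by
  have hx := h.sum_pos
  have e : (4 * (a + b)) * (D - E) = (4 * (a + b)) * (S * (a - c) / 2) := by
    rw [← h.area_AC]
    have h1 : (D + E) * (D - E) = 2 * S * (a * d - b * c) := by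
      linear_combination h.D_sq - h.E_sq
    have hd : d = a + b - c := by linarith [h.add_eq]
    rw [h1, h.area_AC, hd]; ring
  exact mul_left_cancel₀ (by positivity) e

theorem sub_M_N (h : AreaRelations a b c d N M D E S T) :
    2 * (a + b) * (M - N) = T * (a - d) * (a - c) := by
  have h1 : (N + M) * (M - N) = 2 * T * (c * d - a * b) := by
    linear_combination h.M_sq - h.N_sq
  have hd : d = a + b - c := by linarith [h.add_eq]
  rw [h.area_OB, hd] at h1
  rw [hd]
  linarith

theorem S_sub_eight (h : AreaRelations a b c d N M D E S T) :
    (S - 8) * (a + b) ^ 2 = T * ((a - d) ^ 2 + 2 * S) := by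
  linarith [h.diag]

theorem S_sub_eight_pos (h : AreaRelations a b c d N M D E S T) : 0 < S - 8 := by
  have h1 := h.S_sub_eight
  have hS := h.S_pos
  have hT := h.T_pos
  have : 0 < (S - 8) * (a + b) ^ 2 := by rw [h1]; positivity
  exact pos_of_mul_pos_left this (by positivity)

/-- Sum and difference of `D` and `E` are known, so `D = 2(a + b) + S(a - c)/4`. Substituting this
into `D² = S(2ad - S)` and using the diagonal relation gives the claim multiplied by `S - 8`, which
is positive. -/
theorem mul_sq (h : AreaRelations a b c d N M D E S T) :
    T * S * (a - c) ^ 2 = 8 * (T - S) * (a + b) ^ 2 := by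
  have h1 := h.S_sub_eight
  have hD : D = 2 * (a + b) + S * (a - c) / 4 := by linarith [h.sub_D_E, h.area_AC]
  have h2 := h.D_sq
  have hd : d = a + b - c := by linarith [h.add_eq]
  have hpos := h.S_sub_eight_pos
  have hS := h.S_pos
  rw [hD] at h2
  subst hd
  have hne : (S - 8) ≠ 0 := hpos.ne'
  apply mul_left_cancel₀ hne
  linear_combination 16 * T * h2 + 8 * S * h1

/-- By `mul_sq`, equality would give `T·D·E = 0`, that is, a degenerate triangle `OAC` or `ABC`. -/
theorem ne_eight (h : AreaRelations a b c d N M D E S T) : S * (T - S) ≠ 8 * T := by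
  intro h3
  have h1 := h.mul_sq
  have hD : D = 2 * (a + b) + S * (a - c) / 4 := by linarith [h.sub_D_E, h.area_AC]
  have hE : E = 2 * (a + b) - S * (a - c) / 4 := by linarith [h.sub_D_E, h.area_AC]
  have hT := h.T_pos
  have : T * (D * E) = 0 := by
    rw [hD, hE]
    linear_combination (-S / 16) * h1 - (a + b) ^ 2 / 2 * h3
  exact mul_ne_zero hT.ne' (mul_ne_zero h.D_ne h.E_ne) this

variable {W : ℝ}

/-- The hypothesis on `W` is the power of `B` with respect to the circle `OAC`, scaled by `-D`.
Multiplied by `2S`, it collapses because `S·ad` and `S·bc` can be expressed through `D²`, `E²` and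
`S²`. -/
theorem two_S_mul (h : AreaRelations a b c d N M D E S T)
    (hW : 4 * (a + b) * W = -(D * (b * c - S) + E * (a * d - S))) :
    2 * S * W = S ^ 2 - D * E := by
  have hx := h.sum_pos
  have e : (4 * (a + b)) * (2 * S * W) = (4 * (a + b)) * (S ^ 2 - D * E) := by
    rw [show (4 * (a + b)) * (2 * S * W) = 2 * S * (4 * (a + b) * W) by ring, hW, ← h.area_AC]
    linear_combination D * h.E_sq + E * h.D_sq
  exact mul_left_cancel₀ (by positivity) e

theorem two_T_mul (h : AreaRelations a b c d N M D E S T)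
    (hW : 4 * (a + b) * W = N * (T - c * d) + M * (T - a * b)) :
    2 * T * W = T ^ 2 - N * M := by
  have hx := h.sum_pos
  have e : (4 * (a + b)) * (2 * T * W) = (4 * (a + b)) * (T ^ 2 - N * M) := by
    rw [show (4 * (a + b)) * (2 * T * W) = 2 * T * (4 * (a + b) * W) by ring, hW, ← h.area_OB]
    linear_combination N * h.M_sq + M * h.N_sq
  exact mul_left_cancel₀ (by positivity) e

/-- The identity `(D² + S²)(E² + S²) = (S² - DE)² + S²(D + E)²`, in which `D² + S² = 2S·ad` and `E²
+ S² = 2S·bc`. -/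
theorem W_sq (h : AreaRelations a b c d N M D E S T) (hW : 2 * S * W = S ^ 2 - D * E) :
    W ^ 2 = a * b * c * d - 4 * (a + b) ^ 2 := by
  have hS := h.S_pos
  have e : (4 * S ^ 2) * W ^ 2 = (4 * S ^ 2) * (a * b * c * d - 4 * (a + b) ^ 2) := by
    have h1 : (2 * S * W) ^ 2 = (S ^ 2 - D * E) ^ 2 := by rw [hW]
    have h2 : 4 * S ^ 2 * (a * b * c * d) = (D ^ 2 + S ^ 2) * (E ^ 2 + S ^ 2) := by
      rw [h.D_sq, h.E_sq]; ring
    have h3 : (D + E) ^ 2 = (4 * (a + b)) ^ 2 := by rw [h.area_AC]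
    linear_combination h1 - h2 - S ^ 2 * h3
  exact mul_left_cancel₀ (by positivity) e

theorem sigma_eq (h : AreaRelations a b c d N M D E S T) (hW : 2 * S * W = S ^ 2 - D * E) :
    8 * ((a * d + b * c + 2 * W) / (16 + (a - c) ^ 2)) = S := by
  have hS := h.S_pos
  have e : (2 * S) * (8 * (a * d + b * c + 2 * W)) = (2 * S) * (S * (16 + (a - c) ^ 2)) := by
    have h1 := h.sub_D_E
    have h2 : (D - E) ^ 2 = (S * (a - c) / 2) ^ 2 := by rw [h1]
    linear_combination 16 * hW - 8 * h.D_sq - 8 * h.E_sq + 8 * h2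
  have e' := mul_left_cancel₀ (by positivity) e
  rw [← mul_div_assoc, div_eq_iff (by positivity)]
  exact e'

theorem tau_eq (h : AreaRelations a b c d N M D E S T) (hW : 2 * T * W = T ^ 2 - N * M) :
    8 * (a + b) ^ 2 * ((a * b + c * d + 2 * W) / (16 * (a + b) ^ 2 + (a - c) ^ 2 * (a - d) ^ 2))
      = T := by
  have hT := h.T_pos
  have hx := h.sum_pos
  have e : (2 * T) * (8 * (a + b) ^ 2 * (a * b + c * d + 2 * W)) =
      (2 * T) * (T * (16 * (a + b) ^ 2 + (a - c) ^ 2 * (a - d) ^ 2)) := by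
    have h2 : (2 * (a + b) * (M - N)) ^ 2 = (T * (a - d) * (a - c)) ^ 2 := by rw [h.sub_M_N]
    linear_combination (a + b) ^ 2 * (16 * hW - 8 * h.N_sq - 8 * h.M_sq) + 2 * h2
  have e' := mul_left_cancel₀ (by positivity) e
  rw [← mul_div_assoc, div_eq_iff (by positivity)]
  exact e'

end AreaRelations

theorem lt_of_sq_add_sq {p q r : ℝ} (hp : 0 ≤ p) (hr : r ≠ 0) (h : p ^ 2 = q ^ 2 + r ^ 2) :
    q < p := by
  have : q ^ 2 < p ^ 2 := by have := sq_pos_of_ne_zero hr; linarith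
  exact lt_of_pow_lt_pow_left₀ 2 hp this

/-- The relations hold for a quadrilateral with the given coordinates. -/
theorem areaRelations_of_coordinates {a₁ a₂ b₁ b₂ c₁ c₂ a b c d : ℝ} (ha : 0 < a) (hb : 0 < b)
    (hd : 0 < d) (ha2 : a ^ 2 = a₁ ^ 2 + a₂ ^ 2)
    (hb2 : b ^ 2 = (b₁ - a₁) ^ 2 + (b₂ - a₂) ^ 2)
    (hc2 : c ^ 2 = (b₁ - c₁) ^ 2 + (b₂ - c₂) ^ 2) (hd2 : d ^ 2 = c₁ ^ 2 + c₂ ^ 2)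
    (habcd : a + b = c + d) (hN : a₁ * b₂ - a₂ * b₁ ≠ 0) (hD : a₁ * c₂ - a₂ * c₁ ≠ 0)
    (hE : (b₁ - a₁) * (c₂ - a₂) - (b₂ - a₂) * (c₁ - a₁) ≠ 0)
    (harea : (a₁ * b₂ - a₂ * b₁) + (b₁ * c₂ - b₂ * c₁) = 4 * (a + b)) :
    AreaRelations a b c d (a₁ * b₂ - a₂ * b₁) (b₁ * c₂ - b₂ * c₁) (a₁ * c₂ - a₂ * c₁)
      ((b₁ - a₁) * (c₂ - a₂) - (b₂ - a₂) * (c₁ - a₁))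
      (a * d - (a₁ * c₁ + a₂ * c₂)) (a * b + a ^ 2 - (a₁ * b₁ + a₂ * b₂)) := by
  have hS' : a * d - (a₁ * c₁ + a₂ * c₂) =
      b * c - ((a₁ - b₁) * (c₁ - b₁) + (a₂ - b₂) * (c₂ - b₂)) := by
    have h1 : (a - d) ^ 2 = (c - b) ^ 2 := by rw [show a - d = c - b by linarith]
    linear_combination (-1 / 2) * h1 + (1 / 2) * ha2 + (1 / 2) * hd2 - (1 / 2) * hb2 -
      (1 / 2) * hc2
  have hT' : a * b + a ^ 2 - (a₁ * b₁ + a₂ * b₂) =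
      c * d + d ^ 2 - (c₁ * b₁ + c₂ * b₂) := by
    have h1 : (a + b) ^ 2 = (c + d) ^ 2 := by rw [habcd]
    linear_combination (1 / 2) * h1 + (1 / 2) * ha2 - (1 / 2) * hd2 - (1 / 2) * hb2 +
      (1 / 2) * hc2
  have qD : (a * d) ^ 2 = (a₁ * c₁ + a₂ * c₂) ^ 2 + (a₁ * c₂ - a₂ * c₁) ^ 2 := by
    rw [mul_pow, ha2, hd2]; ring
  have qN : (a * b) ^ 2 = (a₁ * (b₁ - a₁) + a₂ * (b₂ - a₂)) ^ 2 + (a₁ * b₂ - a₂ * b₁) ^ 2 := by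
    rw [mul_pow, ha2, hb2]; ring
  have qM : (c * d) ^ 2 = (c₁ * (b₁ - c₁) + c₂ * (b₂ - c₂)) ^ 2 + (b₁ * c₂ - b₂ * c₁) ^ 2 := by
    rw [mul_pow, hc2, hd2]; ring
  have qE : (b * c) ^ 2 = ((a₁ - b₁) * (c₁ - b₁) + (a₂ - b₂) * (c₂ - b₂)) ^ 2 +
      ((b₁ - a₁) * (c₂ - a₂) - (b₂ - a₂) * (c₁ - a₁)) ^ 2 := by
    rw [mul_pow, hb2, hc2]; ring
  have hbb : b₁ ^ 2 + b₂ ^ 2 = (a + b) ^ 2 - 2 * (a * b + a ^ 2 - (a₁ * b₁ + a₂ * b₂)) := by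
    linear_combination ha2 - hb2
  have hqq : (a₁ - c₁) ^ 2 + (a₂ - c₂) ^ 2 =
      (a - d) ^ 2 + 2 * (a * d - (a₁ * c₁ + a₂ * c₂)) := by
    linear_combination -ha2 - hd2
  refine ⟨by positivity, habcd, harea, by rw [← harea]; ring,
    by linarith [lt_of_sq_add_sq (by positivity) hD qD],
    by linarith [lt_of_sq_add_sq (by positivity) hN qN], by linear_combination -qD, ?_, ?_, ?_,
    ?_, hD, hE⟩
  · rw [hS']; linear_combination -qE
  · have : a * b + a ^ 2 - (a₁ * b₁ + a₂ * b₂) = a * b - (a₁ * (b₁ - a₁) + a₂ * (b₂ - a₂)) := by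
      rw [ha2]; ring
    rw [this]; linear_combination -qN
  · have : c * d + d ^ 2 - (c₁ * b₁ + c₂ * b₂) = c * d - (c₁ * (b₁ - c₁) + c₂ * (b₂ - c₂)) := by
      rw [hd2]; ring
    rw [hT', this]; linear_combination -qM
  · rw [← hbb, ← hqq]
    have hcross : (a₁ * b₂ - a₂ * b₁) + (b₁ * c₂ - b₂ * c₁) = 4 * (a + b) := harea
    have hdot : b₁ * (a₁ - c₁) + b₂ * (a₂ - c₂) = (a + b) * (a - d) := by
      have hd' : d = a + b - c := by linarith
      subst hd'
      linear_combination (-1 / 2) * ha2 + (1 / 2) * hb2 - (1 / 2) * hc2 + (1 / 2) * hd2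
    -- Lagrange's identity for the two diagonals: their cross product is twice the area and their
    -- scalar product is `(a + b)(a - d)`.
    have e : (b₁ ^ 2 + b₂ ^ 2) * ((a₁ - c₁) ^ 2 + (a₂ - c₂) ^ 2) =
        ((a₁ * b₂ - a₂ * b₁) + (b₁ * c₂ - b₂ * c₁)) ^ 2 +
          (b₁ * (a₁ - c₁) + b₂ * (a₂ - c₂)) ^ 2 := by ring
    rw [e, hcross, hdot]; ring

/-! ### Integrality of the sides, the sign δ, and the conclusion in coordinates -/

theorem exists_int_of_sq {p : ℝ} (hp : 0 < p) {m : ℤ} (h : p ^ 2 = m) {q : ℚ} (hq : p = q) :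
    ∃ n : ℤ, p = n := by
  have h1 : q * q = (m : ℚ) := by
    have : (q : ℝ) * q = (m : ℝ) := by rw [← hq, ← h]; ring
    exact_mod_cast this
  obtain ⟨k, hk⟩ := Rat.isSquare_intCast_iff.1 ⟨q, h1.symm⟩
  refine ⟨|k|, ?_⟩
  have h2 : p ^ 2 = (|(k : ℝ)|) ^ 2 := by rw [h, hk, sq_abs]; push_cast; ring
  push_cast
  exact (sq_eq_sq₀ hp.le (abs_nonneg _)).1 h2

/-- Two lengths with integer squares are integers when their sum is rational. -/
theorem exists_int_of_add {p q : ℝ} (hp : 0 < p) (hq : 0 < q) {m n k : ℤ} (h1 : p ^ 2 = m)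
    (h2 : q ^ 2 = n) (h3 : (k : ℝ) = 4 * (p + q)) : ∃ i j : ℤ, p = i ∧ q = j := by
  have hk : (k : ℝ) ≠ 0 := by rw [h3]; positivity
  have hpq : p + q ≠ 0 := by positivity
  have h4 : p - q = 4 * (m - n) / k := by
    rw [eq_div_iff hk, ← h1, ← h2, h3]; ring
  have hsum : p + q = k / 4 := by linarith
  obtain ⟨i, hi⟩ := exists_int_of_sq hp h1 (q := (k / 4 + 4 * (m - n) / k) / 2)
    (by push_cast; linarith)
  obtain ⟨j, hj⟩ := exists_int_of_sq hq h2 (q := (k / 4 - 4 * (m - n) / k) / 2)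
    (by push_cast; linarith)
  exact ⟨i, j, hi, hj⟩

/-- In the application `e` has the sign of the power of `B`, so δ selects the sign of the root `W`.
When `e = 0` the root vanishes and the value of δ does not matter. -/
theorem delta_mul_sqrt {W R δ e : ℝ} (hW : W ^ 2 = R)
    (hδ : (e < 0 ∧ δ = 1) ∨ (0 ≤ e ∧ δ = -1)) {x : ℝ} (hx : 0 < x) (he : x * W = -e) :
    δ * Real.sqrt R = W := by
  rw [← hW, Real.sqrt_sq_eq_abs]
  rcases hδ with ⟨h, rfl⟩ | ⟨h, rfl⟩
  · have : 0 < W := pos_of_mul_pos_right (by linarith : 0 < x * W) hx.le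
    rw [abs_of_pos this, one_mul]
  · have : W ≤ 0 := nonpos_of_mul_nonpos_right (by linarith : x * W ≤ 0) hx
    rw [abs_of_nonpos this]; ring

namespace TangentConfig

variable {a₁ a₂ b₁ b₂ c₁ c₂ : ℤ} {i₁ i₂ r u s w v : ℝ}

theorem conclusion_of_pos (h : TangentConfig a₁ a₂ b₁ b₂ c₁ c₂ i₁ i₂ r u s w v)
    (hN : 0 < (a₁ * b₂ - a₂ * b₁ : ℝ)) {a b c d δ : ℝ} (ha : 0 < a) (hb : 0 < b) (hc : 0 < c)
    (hd : 0 < d) (ha2 : a ^ 2 = a₁ ^ 2 + a₂ ^ 2) (hb2 : b ^ 2 = (b₁ - a₁) ^ 2 + (b₂ - a₂) ^ 2)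
    (hc2 : c ^ 2 = (b₁ - c₁) ^ 2 + (b₂ - c₂) ^ 2) (hd2 : d ^ 2 = c₁ ^ 2 + c₂ ^ 2)
    (hkite : ¬ (a = d ∧ b = c))
    (harea : 0 < (a₁ * b₂ - a₂ * b₁ : ℝ) * (b₁ * c₂ - b₂ * c₁) →
      |(a₁ * b₂ - a₂ * b₁ : ℝ) + (b₁ * c₂ - b₂ * c₁)| / 2 = a + b + c + d)
    (hδ : ((a₁ * c₂ - a₂ * c₁ : ℝ) *
        ((a₁ * c₂ - a₂ * c₁) * ((a₁ - b₁) * (c₁ - b₁) + (a₂ - b₂) * (c₂ - b₂)) +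
        ((b₁ - a₁) * (c₂ - a₂) - (b₂ - a₂) * (c₁ - a₁)) * (a₁ * c₁ + a₂ * c₂)) < 0 ∧ δ = 1) ∨
      (0 ≤ (a₁ * c₂ - a₂ * c₁ : ℝ) *
        ((a₁ * c₂ - a₂ * c₁) * ((a₁ - b₁) * (c₁ - b₁) + (a₂ - b₂) * (c₂ - b₂)) +
        ((b₁ - a₁) * (c₂ - a₂) - (b₂ - a₂) * (c₁ - a₁)) * (a₁ * c₁ + a₂ * c₂)) ∧ δ = -1)) :
    ∃ s t : ℤ,
      8 * ((a * d + b * c + 2 * δ * Real.sqrt (a * b * c * d - 4 * (a + b) ^ 2)) /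
        (16 + (a - c) ^ 2)) = s ∧
      8 * (a + b) ^ 2 * ((a * b + c * d + 2 * δ * Real.sqrt (a * b * c * d - 4 * (a + b) ^ 2)) /
        (16 * (a + b) ^ 2 + (a - c) ^ 2 * (a - d) ^ 2)) = t ∧
      ((s = 9 ∧ t = 18) ∨ (s = 18 ∧ t = 50) ∨
        (∃ m n Y Z : ℤ, s = 5 * m ^ 2 ∧ t = 5 * m ^ 2 + 5 ∧
          m ^ 2 - 10 * n ^ 2 = -1 ∧ (5 * m ^ 2 - 8) * Y ^ 2 = 5 + 8 * Z ^ 2) ∨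
        (∃ m n Y Z : ℤ, s = m ^ 2 ∧ t = m ^ 2 + 1 ∧
          m ^ 2 - 2 * n ^ 2 = -1 ∧ (m ^ 2 - 8) * Y ^ 2 = 1 + 8 * Z ^ 2)) := by
  obtain ⟨hM, hD, habcd, hca⟩ := h.shape hN ha hb hc hd ha2 hb2 hc2 hd2
  have hsum : (a₁ * b₂ - a₂ * b₁ : ℝ) + (b₁ * c₂ - b₂ * c₁) = 4 * (a + b) := by
    have := harea (mul_pos hN hM)
    rw [abs_of_pos (add_pos hN hM)] at this
    linarith
  have hR := areaRelations_of_coordinates ha hb hd ha2 hb2 hc2 hd2 habcd hN.ne' hD.ne' h.ne_ABC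
    hsum
  -- The right side is minus `det(OAC)` times the power of `B` with respect to the circle `OAC`. It
  -- serves for both S and T.
  obtain ⟨W, hW⟩ : ∃ W : ℝ, 4 * (a + b) * W =
      -((a₁ * c₂ - a₂ * c₁) * ((a₁ - b₁) * (c₁ - b₁) + (a₂ - b₂) * (c₂ - b₂)) +
        ((b₁ - a₁) * (c₂ - a₂) - (b₂ - a₂) * (c₁ - a₁)) * (a₁ * c₁ + a₂ * c₂)) :=
    ⟨_ / (4 * (a + b)), mul_div_cancel₀ _ (by positivity)⟩
  have hWS := hR.two_S_mul (W := W) (by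
    have h1 : (a - d) ^ 2 = (c - b) ^ 2 := by rw [show a - d = c - b by linarith]
    rw [hW]
    linear_combination (a₁ * c₂ - a₂ * c₁ : ℝ) * ((1 / 2) * h1 - (1 / 2) * ha2 - (1 / 2) * hd2 +
      (1 / 2) * hb2 + (1 / 2) * hc2))
  have hWT := hR.two_T_mul (W := W) (by
    have h1 : (a + b) ^ 2 = (c + d) ^ 2 := by rw [habcd]
    rw [hW]
    linear_combination (a₁ * b₂ - a₂ * b₁ : ℝ) * (-(1 / 2) * h1 - (1 / 2) * ha2 - (1 / 2) * hd2 +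
      (1 / 2) * hb2 - (1 / 2) * hc2) - (b₁ * c₂ - b₂ * c₁ : ℝ) * ha2)
  have hsqrt : δ * Real.sqrt (a * b * c * d - 4 * (a + b) ^ 2) = W := by
    refine delta_mul_sqrt (hR.W_sq hWS) hδ (x := (a₁ * c₂ - a₂ * c₁ : ℝ) * (4 * (a + b)))
      (by positivity) ?_
    rw [mul_assoc, hW]; ring
  have e2 : 2 * δ * Real.sqrt (a * b * c * d - 4 * (a + b) ^ 2) = 2 * W := by
    rw [mul_assoc, hsqrt]
  rw [e2, hR.sigma_eq hWS, hR.tau_eq hWT]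
  -- `4(a + b)` is the integer `N + M`; with integer squares of `a` and `b`, the difference `a - b`
  -- is rational as well.
  obtain ⟨ia, ib, hia, hib⟩ := exists_int_of_add ha hb (m := a₁ ^ 2 + a₂ ^ 2)
    (n := (b₁ - a₁) ^ 2 + (b₂ - a₂) ^ 2) (k := (a₁ * b₂ - a₂ * b₁) + (b₁ * c₂ - b₂ * c₁))
    (by rw [ha2]; push_cast; ring) (by rw [hb2]; push_cast; ring)
    (by rw [← hsum]; push_cast; ring)
  obtain ⟨ic, id, hic, hid⟩ := exists_int_of_add hc hd (m := (b₁ - c₁) ^ 2 + (b₂ - c₂) ^ 2)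
    (n := c₁ ^ 2 + c₂ ^ 2) (k := (a₁ * b₂ - a₂ * b₁) + (b₁ * c₂ - b₂ * c₁))
    (by rw [hc2]; push_cast; ring) (by rw [hd2]; push_cast; ring)
    (by rw [← habcd, ← hsum]; push_cast; ring)
  obtain ⟨S, hS⟩ : ∃ S : ℤ, a * d - (a₁ * c₁ + a₂ * c₂) = S :=
    ⟨ia * id - (a₁ * c₁ + a₂ * c₂), by rw [hia, hid]; push_cast; ring⟩
  obtain ⟨T, hT⟩ : ∃ T : ℤ, a * b + a ^ 2 - (a₁ * b₁ + a₂ * b₂) = T :=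
    ⟨ia * ib + ia ^ 2 - (a₁ * b₁ + a₂ * b₂), by rw [hia, hib]; push_cast; ring⟩
  rw [hS, hT] at hR ⊢
  subst hia hib hic hid
  refine ⟨S, T, rfl, rfl, ?_⟩
  obtain ⟨N, hNe⟩ : ∃ N, N = a₁ * b₂ - a₂ * b₁ := ⟨_, rfl⟩
  obtain ⟨M, hMe⟩ : ∃ M, M = b₁ * c₂ - b₂ * c₁ := ⟨_, rfl⟩
  have hNr : (a₁ * b₂ - a₂ * b₁ : ℝ) = N := by rw [hNe]; push_cast; ring
  have hMr : (b₁ * c₂ - b₂ * c₁ : ℝ) = M := by rw [hMe]; push_cast; ring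
  rw [hNr] at hR hN hsum
  rw [hMr] at hR hM hsum
  have z1 : N + M = 4 * (ia + ib) := by exact_mod_cast hsum
  have z2 := hR.sub_M_N
  have z3 := hR.S_sub_eight
  have z4 := hR.mul_sq
  have z5 := hR.ne_eight
  have z6 := hR.S_pos
  have z7 := hR.T_pos
  have z8 := hR.sum_pos
  norm_cast at z2 z3 z4 z5 z6 z7 z8 hN hM hca
  have hne : ia ≠ id := by
    rintro rfl
    refine hkite ⟨rfl, ?_⟩
    linarith
  -- `N + M` is a multiple of 4, so `M - N` is even. Positivity of `N` and `M` gives `|M - N| < N +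
  -- M`, which is `|f| < 2(a + b)`.
  obtain ⟨f, hf⟩ : ∃ f, M - N = 2 * f := ⟨(M - N) / 2, by omega⟩
  rw [hf] at z2
  rcases lt_or_gt_of_ne hne with hlt | hlt
  · refine classification (x := ia + ib) (y := id - ia) (z := ia - ic) (f := -f) z8 (by omega)
      (by omega) z6 z7 ?_ ?_ ?_ (by omega) z5
    · linear_combination z3
    · linear_combination z4
    · linear_combination -z2
  · refine classification (x := ia + ib) (y := ia - id) (z := ia - ic) (f := f) z8 (by omega)
      (by omega) z6 z7 ?_ ?_ ?_ (by omega) z5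
    · linear_combination z3
    · linear_combination z4
    · linear_combination z2

theorem conclusion (h : TangentConfig a₁ a₂ b₁ b₂ c₁ c₂ i₁ i₂ r u s w v)
    {a b c d δ : ℝ} (ha : 0 < a) (hb : 0 < b) (hc : 0 < c)
    (hd : 0 < d) (ha2 : a ^ 2 = a₁ ^ 2 + a₂ ^ 2) (hb2 : b ^ 2 = (b₁ - a₁) ^ 2 + (b₂ - a₂) ^ 2)
    (hc2 : c ^ 2 = (b₁ - c₁) ^ 2 + (b₂ - c₂) ^ 2) (hd2 : d ^ 2 = c₁ ^ 2 + c₂ ^ 2)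
    (hkite : ¬ (a = d ∧ b = c))
    (harea : 0 < (a₁ * b₂ - a₂ * b₁ : ℝ) * (b₁ * c₂ - b₂ * c₁) →
      |(a₁ * b₂ - a₂ * b₁ : ℝ) + (b₁ * c₂ - b₂ * c₁)| / 2 = a + b + c + d)
    (hδ : ((a₁ * c₂ - a₂ * c₁ : ℝ) *
        ((a₁ * c₂ - a₂ * c₁) * ((a₁ - b₁) * (c₁ - b₁) + (a₂ - b₂) * (c₂ - b₂)) +
        ((b₁ - a₁) * (c₂ - a₂) - (b₂ - a₂) * (c₁ - a₁)) * (a₁ * c₁ + a₂ * c₂)) < 0 ∧ δ = 1) ∨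
      (0 ≤ (a₁ * c₂ - a₂ * c₁ : ℝ) *
        ((a₁ * c₂ - a₂ * c₁) * ((a₁ - b₁) * (c₁ - b₁) + (a₂ - b₂) * (c₂ - b₂)) +
        ((b₁ - a₁) * (c₂ - a₂) - (b₂ - a₂) * (c₁ - a₁)) * (a₁ * c₁ + a₂ * c₂)) ∧ δ = -1)) :
    ∃ s t : ℤ,
      8 * ((a * d + b * c + 2 * δ * Real.sqrt (a * b * c * d - 4 * (a + b) ^ 2)) /
        (16 + (a - c) ^ 2)) = s ∧
      8 * (a + b) ^ 2 * ((a * b + c * d + 2 * δ * Real.sqrt (a * b * c * d - 4 * (a + b) ^ 2)) /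
        (16 * (a + b) ^ 2 + (a - c) ^ 2 * (a - d) ^ 2)) = t ∧
      ((s = 9 ∧ t = 18) ∨ (s = 18 ∧ t = 50) ∨
        (∃ m n Y Z : ℤ, s = 5 * m ^ 2 ∧ t = 5 * m ^ 2 + 5 ∧
          m ^ 2 - 10 * n ^ 2 = -1 ∧ (5 * m ^ 2 - 8) * Y ^ 2 = 5 + 8 * Z ^ 2) ∨
        (∃ m n Y Z : ℤ, s = m ^ 2 ∧ t = m ^ 2 + 1 ∧
          m ^ 2 - 2 * n ^ 2 = -1 ∧ (m ^ 2 - 8) * Y ^ 2 = 1 + 8 * Z ^ 2)) := by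
  rcases lt_trichotomy (a₁ * b₂ - a₂ * b₁ : ℝ) 0 with hN | hN | hN
  · refine h.swap.conclusion_of_pos (by linarith) ha hb hc hd (by linarith) (by linarith)
      (by linarith) (by linarith) hkite (fun hp => ?_) ?_
    · rw [← harea (by linarith), ← abs_neg]
      congr 2
      ring
    · convert hδ using 3
      · ring
      · ring
  · have := h.sep_AB
    rw [hN, zero_mul] at this
    exact (lt_irrefl _ this).elim
  · exact h.conclusion_of_pos hN ha hb hc hd ha2 hb2 hc2 hd2 hkite harea hδ

end TangentConfig

/-! ### Lines, crossings, tangency and circumcircles in coordinates -/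

/-- Twice the signed area of the triangle `PQR`. -/
def det3 (P Q R : Plane) : ℝ :=
  (Q 0 - P 0) * (R 1 - P 1) - (Q 1 - P 1) * (R 0 - P 0)

theorem dist_sq_eq (P Q : Plane) : dist P Q ^ 2 = (P 0 - Q 0) ^ 2 + (P 1 - Q 1) ^ 2 := by
  rw [EuclideanSpace.dist_eq, Real.sq_sqrt (by positivity)]
  simp [Real.dist_eq, Fin.sum_univ_two, sq_abs]

theorem lineMap_coord (P Q : Plane) (t : ℝ) (i : Fin 2) :
    (AffineMap.lineMap P Q t : Plane) i = P i + t * (Q i - P i) := by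
  simp [AffineMap.lineMap_apply]
  ring

theorem plane_ext {P Q : Plane} (h0 : P 0 = Q 0) (h1 : P 1 = Q 1) : P = Q := by
  ext i
  fin_cases i
  · exact h0
  · exact h1

theorem plane_ne {P Q : Plane} (h : P ≠ Q) : 0 < (Q 0 - P 0) ^ 2 + (Q 1 - P 1) ^ 2 := by
  rcases eq_or_ne (Q 0) (P 0) with h0 | h0
  · rcases eq_or_ne (Q 1) (P 1) with h1 | h1
    · exact absurd (plane_ext h0.symm h1.symm) h
    · have := sq_pos_of_ne_zero (sub_ne_zero.2 h1)
      positivity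
  · have := sq_pos_of_ne_zero (sub_ne_zero.2 h0)
    positivity

theorem mem_line_iff {P Q R : Plane} (hPQ : P ≠ Q) : R ∈ line[ℝ, P, Q] ↔ det3 P Q R = 0 := by
  rw [mem_affineSpan_pair_iff_exists_lineMap_eq]
  constructor
  · rintro ⟨t, rfl⟩
    simp only [det3, lineMap_coord]
    ring
  · intro h
    have hpos := plane_ne hPQ
    rw [det3] at h
    refine ⟨((R 0 - P 0) * (Q 0 - P 0) + (R 1 - P 1) * (Q 1 - P 1)) /
      ((Q 0 - P 0) ^ 2 + (Q 1 - P 1) ^ 2), ?_⟩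
    apply plane_ext
    · rw [lineMap_coord]
      field_simp
      linear_combination (Q 1 - P 1) * h
    · rw [lineMap_coord]
      field_simp
      linear_combination (-(Q 0 - P 0)) * h

theorem det3_ne_zero {P Q R : Plane} (h : ¬ Collinear ℝ {P, Q, R}) : det3 P Q R ≠ 0 := by
  intro h0
  apply h
  rcases eq_or_ne P Q with rfl | hPQ
  · simpa using collinear_pair ℝ P R
  · have h1 := (mem_line_iff hPQ).2 h0
    have := (collinear_insert_iff_of_mem_affineSpan h1).2 (collinear_pair ℝ P Q)
    rwa [show ({R, P, Q} : Set Plane) = {P, Q, R} by ext; simp; tauto] at this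

theorem ne_of_not_collinear {P Q R : Plane} (h : ¬ Collinear ℝ {P, Q, R}) : P ≠ Q := by
  rintro rfl
  exact h (by simpa using collinear_pair ℝ P R)

theorem sOppSide_iff {P Q X Y : Plane} (hPQ : P ≠ Q) :
    (line[ℝ, P, Q]).SOppSide X Y ↔ det3 P Q X * det3 P Q Y < 0 := by
  have hP : P ∈ line[ℝ, P, Q] := left_mem_affineSpan_pair ℝ P Q
  rw [AffineSubspace.sOppSide_iff_exists_left hP, mem_line_iff hPQ, mem_line_iff hPQ]
  constructor
  · rintro ⟨hX, hY, R, hR, hray⟩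
    rw [mem_line_iff hPQ] at hR
    have key : ∃ m n : ℝ, 0 < m ∧ 0 < n ∧ m * det3 P Q X = n * (-det3 P Q Y) := by
      have hXP : X -ᵥ P ≠ 0 := by
        intro h0
        rw [vsub_eq_zero_iff_eq] at h0
        exact hX (by rw [h0, det3]; ring)
      have hRY : R -ᵥ Y ≠ 0 := by
        intro h0
        rw [vsub_eq_zero_iff_eq] at h0
        exact hY (h0 ▸ hR)
      obtain ⟨m, n, hm, hn, hmn⟩ := hray.exists_pos hXP hRY
      refine ⟨m, n, hm, hn, ?_⟩
      have e0 := congrArg (fun v : Plane => v 0) hmn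
      have e1 := congrArg (fun v : Plane => v 1) hmn
      simp only [vsub_eq_sub, PiLp.smul_apply, PiLp.sub_apply, smul_eq_mul] at e0 e1
      rw [det3] at hR
      simp only [det3]
      linear_combination (Q 0 - P 0) * e1 - (Q 1 - P 1) * e0 + n * hR
    obtain ⟨m, n, hm, hn, hmn⟩ := key
    rcases lt_or_gt_of_ne hX with h | h
    · have h1 : n * (-det3 P Q Y) < 0 := by rw [← hmn]; exact mul_neg_of_pos_of_neg hm h
      have h2 := neg_of_mul_neg_right h1 hn.le
      exact mul_neg_of_neg_of_pos h (by linarith)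
    · have h1 : 0 < n * (-det3 P Q Y) := by rw [← hmn]; exact mul_pos hm h
      have h2 := pos_of_mul_pos_right h1 hn.le
      exact mul_neg_of_pos_of_neg h (by linarith)
  · intro h
    have hX : det3 P Q X ≠ 0 := left_ne_zero_of_mul h.ne
    have hY : det3 P Q Y ≠ 0 := right_ne_zero_of_mul h.ne
    have hl : 0 ≤ -det3 P Q Y / det3 P Q X := by
      rw [← mul_div_mul_right _ _ hX]
      exact div_nonneg (by linarith) (mul_self_nonneg _)
    -- Moving from `Y` in the direction `X - P` changes `det3 P Q` at the rate `det3 P Q X`; this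
    -- multiple is where the line is reached.
    refine ⟨hX, hY, (-det3 P Q Y / det3 P Q X) • (X -ᵥ P) +ᵥ Y, ?_, ?_⟩
    · rw [mem_line_iff hPQ]
      obtain ⟨l, hl⟩ : ∃ l, l = -det3 P Q Y / det3 P Q X := ⟨_, rfl⟩
      have hl' : l * det3 P Q X = -det3 P Q Y := by rw [hl]; exact div_mul_cancel₀ _ hX
      rw [← hl]
      simp only [det3] at hl' ⊢
      simp only [vsub_eq_sub, vadd_eq_add, PiLp.add_apply, PiLp.smul_apply, PiLp.sub_apply,
        smul_eq_mul]
      linear_combination hl'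
    · rw [vadd_vsub]
      exact SameRay.sameRay_nonneg_smul_right _ hl

theorem not_disjoint_openSegment {P Q R S : Plane} (h1 : det3 P Q R * det3 P Q S < 0)
    (h2 : det3 R S P * det3 R S Q < 0) :
    ¬ Disjoint (openSegment ℝ P Q) (openSegment ℝ R S) := by
  have param : ∀ {x y : ℝ}, x * y < 0 → x - y ≠ 0 ∧ x / (x - y) ∈ Set.Ioo (0 : ℝ) 1 := by
    intro x y hxy
    rcases mul_neg_iff.1 hxy with ⟨hx, hy⟩ | ⟨hx, hy⟩
    · have : 0 < x - y := by linarith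
      exact ⟨this.ne', div_pos hx this, (div_lt_one this).2 (by linarith)⟩
    · have : x - y < 0 := by linarith
      exact ⟨this.ne, div_pos_of_neg_of_neg hx this, (div_lt_one_of_neg this).2 (by linarith)⟩
  obtain ⟨n1, m1⟩ := param h1
  obtain ⟨n2, m2⟩ := param h2
  rw [Set.not_disjoint_iff]
  rw [openSegment_eq_image_lineMap, openSegment_eq_image_lineMap]
  -- The signed distance to the other line is affine along each segment, so its zero is at the
  -- parameter `x / (x - y)` determined by the end values.
  refine ⟨_, ⟨_, m2, rfl⟩, ⟨_, m1, ?_⟩⟩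
  apply plane_ext
  · rw [lineMap_coord, lineMap_coord]
    field_simp
    simp only [det3]
    ring
  · rw [lineMap_coord, lineMap_coord]
    field_simp
    simp only [det3]
    ring

theorem exists_contact {S : Sphere Plane} {P Q : Plane} (h : S.IsTangent line[ℝ, P, Q]) :
    ∃ t : ℝ, (P 0 + t * (Q 0 - P 0) - S.center 0) * (Q 0 - P 0) +
        (P 1 + t * (Q 1 - P 1) - S.center 1) * (Q 1 - P 1) = 0 ∧
      (P 0 + t * (Q 0 - P 0) - S.center 0) ^ 2 + (P 1 + t * (Q 1 - P 1) - S.center 1) ^ 2 =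
        S.radius ^ 2 := by
  obtain ⟨p, hp⟩ := h
  obtain ⟨t, rfl⟩ := mem_affineSpan_pair_iff_exists_lineMap_eq.1 hp.mem_space
  refine ⟨t, ?_, ?_⟩
  · have h1 := hp.inner_right_eq_zero_of_mem (left_mem_affineSpan_pair ℝ P Q)
    have h2 := hp.inner_right_eq_zero_of_mem (right_mem_affineSpan_pair ℝ P Q)
    simp only [vsub_eq_sub, PiLp.inner_apply, Fin.sum_univ_two, PiLp.sub_apply, lineMap_coord,
      RCLike.inner_apply, conj_trivial] at h1 h2
    linear_combination h2 - h1
  · have h1 := hp.mem_sphere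
    rw [EuclideanGeometry.mem_sphere] at h1
    rw [← h1, dist_sq_eq, lineMap_coord, lineMap_coord]

/-- The power of `B` with respect to the circle through `O`, `A`, `C`. -/
theorem within_iff {O A B C : Plane} (hD : det3 O A C ≠ 0) :
    (∃ S : Sphere Plane, O ∈ S ∧ A ∈ S ∧ C ∈ S ∧ dist B S.center < S.radius) ↔
      det3 O A C * (det3 O A C * ((A 0 - B 0) * (C 0 - B 0) + (A 1 - B 1) * (C 1 - B 1)) +
        det3 A B C * ((A 0 - O 0) * (C 0 - O 0) + (A 1 - O 1) * (C 1 - O 1))) < 0 := by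
  -- `B` is an affine combination of `O`, `A`, `C` with determinants as weights; the power vanishes
  -- at these three points, and only the quadratic part of the power function contributes.
  have power : ∀ S : Sphere Plane, O ∈ S → A ∈ S → C ∈ S →
      det3 O A C * (dist B S.center ^ 2 - S.radius ^ 2) =
        det3 O A C * ((A 0 - B 0) * (C 0 - B 0) + (A 1 - B 1) * (C 1 - B 1)) +
        det3 A B C * ((A 0 - O 0) * (C 0 - O 0) + (A 1 - O 1) * (C 1 - O 1)) := by
    intro S hO hA hC
    rw [EuclideanGeometry.mem_sphere] at hO hA hC
    have eO : dist O S.center ^ 2 = S.radius ^ 2 := by rw [hO]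
    have eA : dist A S.center ^ 2 = S.radius ^ 2 := by rw [hA]
    have eC : dist C S.center ^ 2 = S.radius ^ 2 := by rw [hC]
    rw [dist_sq_eq] at eO eA eC ⊢
    simp only [det3]
    linear_combination ((A 0 - B 0) * (C 1 - B 1) - (A 1 - B 1) * (C 0 - B 0)) * eO +
      ((B 0 - O 0) * (C 1 - O 1) - (B 1 - O 1) * (C 0 - O 0)) * eA +
      ((A 0 - O 0) * (B 1 - O 1) - (A 1 - O 1) * (B 0 - O 0)) * eC
  have hD2 : 0 < det3 O A C * det3 O A C := mul_self_pos.2 hD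
  constructor
  · rintro ⟨S, hO, hA, hC, hlt⟩
    rw [← power S hO hA hC, ← mul_assoc]
    refine mul_neg_of_pos_of_neg hD2 ?_
    have : dist B S.center ^ 2 < S.radius ^ 2 := by gcongr
    linarith
  · intro h
    -- The circumcentre of `OAC`, by Cramer's rule from the equations of two perpendicular
    -- bisectors.
    obtain ⟨Z, hZ0, hZ1⟩ : ∃ Z : Plane,
        2 * det3 O A C * (Z 0 - O 0) =
          ((A 0 - O 0) ^ 2 + (A 1 - O 1) ^ 2) * (C 1 - O 1) -
          ((C 0 - O 0) ^ 2 + (C 1 - O 1) ^ 2) * (A 1 - O 1) ∧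
        2 * det3 O A C * (Z 1 - O 1) =
          ((C 0 - O 0) ^ 2 + (C 1 - O 1) ^ 2) * (A 0 - O 0) -
          ((A 0 - O 0) ^ 2 + (A 1 - O 1) ^ 2) * (C 0 - O 0) := by
      refine ⟨!₂[O 0 + (((A 0 - O 0) ^ 2 + (A 1 - O 1) ^ 2) * (C 1 - O 1) -
          ((C 0 - O 0) ^ 2 + (C 1 - O 1) ^ 2) * (A 1 - O 1)) / (2 * det3 O A C),
        O 1 + (((C 0 - O 0) ^ 2 + (C 1 - O 1) ^ 2) * (A 0 - O 0) -
          ((A 0 - O 0) ^ 2 + (A 1 - O 1) ^ 2) * (C 0 - O 0)) / (2 * det3 O A C)], ?_, ?_⟩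
      · simp only [Matrix.cons_val_zero, add_sub_cancel_left]
        exact mul_div_cancel₀ _ (mul_ne_zero two_ne_zero hD)
      · simp only [Matrix.cons_val_one, Matrix.cons_val_fin_one,
          add_sub_cancel_left]
        exact mul_div_cancel₀ _ (mul_ne_zero two_ne_zero hD)
    have hA : dist A Z = dist O Z := by
      rw [← sq_eq_sq₀ dist_nonneg dist_nonneg, dist_sq_eq, dist_sq_eq]
      apply mul_left_cancel₀ hD
      rw [det3] at *
      linear_combination (-(A 0 - O 0)) * hZ0 - (A 1 - O 1) * hZ1
    have hC : dist C Z = dist O Z := by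
      rw [← sq_eq_sq₀ dist_nonneg dist_nonneg, dist_sq_eq, dist_sq_eq]
      apply mul_left_cancel₀ hD
      rw [det3] at *
      linear_combination (-(C 0 - O 0)) * hZ0 - (C 1 - O 1) * hZ1
    refine ⟨⟨Z, dist O Z⟩, rfl, hA, hC, ?_⟩
    have h1 := power ⟨Z, dist O Z⟩ rfl hA hC
    rw [← h1, ← mul_assoc] at h
    have h2 := neg_of_mul_neg_right h hD2.le
    exact lt_of_pow_lt_pow_left₀ 2 dist_nonneg (by linarith)

/-! ### Lebesgue measure of triangles and of the quadrilateral -/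

open MeasureTheory

/-- The standard triangle in the coordinate plane. -/
def stdTriangle : Set (Fin 2 → ℝ) := {x | 0 ≤ x 0 ∧ 0 ≤ x 1 ∧ x 0 + x 1 ≤ 1}

theorem volume_stdTriangle : volume stdTriangle = ENNReal.ofReal (1 / 2) := by
  have hmeas : MeasurableSet {p : ℝ × ℝ | 0 ≤ p.1 ∧ 0 ≤ p.2 ∧ p.1 + p.2 ≤ 1} := by
    refine (measurableSet_le measurable_const measurable_fst).inter
      ((measurableSet_le measurable_const measurable_snd).inter
      (measurableSet_le (measurable_fst.add measurable_snd) measurable_const))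
  have h1 : stdTriangle =
      MeasurableEquiv.finTwoArrow ⁻¹' {p : ℝ × ℝ | 0 ≤ p.1 ∧ 0 ≤ p.2 ∧ p.1 + p.2 ≤ 1} := rfl
  rw [h1, (volume_preserving_finTwoArrow ℝ).measure_preimage hmeas.nullMeasurableSet,
    Measure.volume_eq_prod, Measure.prod_apply hmeas]
  have h2 : ∀ x : ℝ, volume (Prod.mk x ⁻¹' {p : ℝ × ℝ | 0 ≤ p.1 ∧ 0 ≤ p.2 ∧ p.1 + p.2 ≤ 1}) =
      (Set.Icc (0 : ℝ) 1).indicator (fun x => ENNReal.ofReal (1 - x)) x := by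
    intro x
    by_cases hx : x ∈ Set.Icc (0 : ℝ) 1
    · rw [Set.indicator_of_mem hx]
      have : Prod.mk x ⁻¹' {p : ℝ × ℝ | 0 ≤ p.1 ∧ 0 ≤ p.2 ∧ p.1 + p.2 ≤ 1} =
          Set.Icc 0 (1 - x) := by
        ext y
        simp only [Set.mem_preimage, Set.mem_ofPred_eq, Set.mem_Icc]
        exact ⟨fun h => ⟨h.2.1, by linarith [h.2.2]⟩, fun h => ⟨hx.1, h.1, by linarith [h.2]⟩⟩
      rw [this, Real.volume_Icc, sub_zero]
    · rw [Set.indicator_of_notMem hx]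
      have : Prod.mk x ⁻¹' {p : ℝ × ℝ | 0 ≤ p.1 ∧ 0 ≤ p.2 ∧ p.1 + p.2 ≤ 1} = ∅ := by
        ext y
        simp only [Set.mem_preimage, Set.mem_ofPred_eq, Set.mem_empty_iff_false, iff_false]
        exact fun h => hx ⟨h.1, by linarith [h.2.1, h.2.2]⟩
      rw [this, measure_empty]
  rw [lintegral_congr h2, lintegral_indicator measurableSet_Icc,
    ← ofReal_integral_eq_lintegral_ofReal]
  · congr 1
    rw [integral_Icc_eq_integral_Ioc, ← intervalIntegral.integral_of_le zero_le_one,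
      intervalIntegral.integral_sub (by simp) (by simp), integral_id]
    simp
    norm_num
  · exact (Continuous.integrableOn_Icc (by fun_prop))
  · refine (ae_restrict_iff' measurableSet_Icc).2 (Filter.Eventually.of_forall fun x hx => ?_)
    exact sub_nonneg.2 hx.2

theorem convexHull_triple_eq (P Q R : Plane) :
    convexHull ℝ {P, Q, R} =
      (fun x : Fin 2 → ℝ => P + x 0 • (Q - P) + x 1 • (R - P)) '' stdTriangle := by
  apply Set.Subset.antisymm
  · apply convexHull_min
    · rintro X (rfl | rfl | rfl)
      · exact ⟨![0, 0], by simp [stdTriangle], by simp⟩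
      · exact ⟨![1, 0], by simp [stdTriangle], by simp⟩
      · exact ⟨![0, 1], by simp [stdTriangle], by simp⟩
    · rintro _ ⟨x, hx, rfl⟩ _ ⟨y, hy, rfl⟩ s t hs ht hst
      refine ⟨s • x + t • y, ⟨?_, ?_, ?_⟩, ?_⟩
      · have := mul_nonneg hs hx.1
        have := mul_nonneg ht hy.1
        simp only [Pi.add_apply, Pi.smul_apply, smul_eq_mul]
        linarith
      · have := mul_nonneg hs hx.2.1
        have := mul_nonneg ht hy.2.1
        simp only [Pi.add_apply, Pi.smul_apply, smul_eq_mul]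
        linarith
      · have := mul_le_mul_of_nonneg_left hx.2.2 hs
        have := mul_le_mul_of_nonneg_left hy.2.2 ht
        simp only [Pi.add_apply, Pi.smul_apply, smul_eq_mul]
        linarith
      · have : P = s • P + t • P := by rw [← add_smul, hst, one_smul]
        simp only [Pi.add_apply, Pi.smul_apply, smul_eq_mul]
        nth_rewrite 1 [this]
        module
  · rintro _ ⟨x, hx, rfl⟩
    have h := (convex_convexHull ℝ ({P, Q, R} : Set Plane)).sum_mem (t := Finset.univ)
      (w := ![1 - x 0 - x 1, x 0, x 1]) (z := ![P, Q, R]) ?_ ?_ ?_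
    · convert h using 1
      simp only [Fin.sum_univ_three, Matrix.cons_val_zero, Matrix.cons_val_one, Matrix.cons_val]
      module
    · intro i _
      fin_cases i
      · exact (by linarith [hx.2.2] : 0 ≤ 1 - x 0 - x 1)
      · exact hx.1
      · exact hx.2.1
    · simp [Fin.sum_univ_three]
      ring
    · intro i _
      apply subset_convexHull
      fin_cases i <;> simp

theorem volume_triangle (P Q R : Plane) :
    volume (convexHull ℝ {P, Q, R}) = ENNReal.ofReal
      (|(Q 0 - P 0) * (R 1 - P 1) - (Q 1 - P 1) * (R 0 - P 0)| / 2) := by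
  have h1 : WithLp.toLp 2 ⁻¹' (convexHull ℝ {P, Q, R} : Set Plane) =
      (fun x => WithLp.ofLp P + x) '' (Matrix.toLin'
        !![Q 0 - P 0, R 0 - P 0; Q 1 - P 1, R 1 - P 1] '' stdTriangle) := by
    rw [convexHull_triple_eq, ← Set.image_comp]
    ext y
    simp only [Set.mem_preimage, Set.mem_image, Function.comp_apply]
    refine exists_congr fun x => and_congr_right fun _ => ?_
    rw [← (WithLp.toLp_injective 2).eq_iff (a := WithLp.ofLp P + _)]
    refine Eq.congr ?_ rfl
    ext i
    fin_cases i
    · simp [Matrix.toLin'_apply, dotProduct, Fin.sum_univ_two]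
      ring
    · simp [Matrix.toLin'_apply, dotProduct, Fin.sum_univ_two]
      ring
  rw [← (PiLp.volume_preserving_toLp (Fin 2)).measure_preimage_emb
    (MeasurableEquiv.toLp 2 (Fin 2 → ℝ)).measurableEmbedding, h1, Set.image_add_left,
    measure_preimage_add, Measure.addHaar_image_linearMap, LinearMap.det_toLin',
    Matrix.det_fin_two_of, volume_stdTriangle, ← ENNReal.ofReal_mul (abs_nonneg _)]
  congr 1
  rw [mul_one_div]
  congr 2
  ring

theorem convex_half_plane (P Q : Plane) (k : ℝ) : Convex ℝ {X : Plane | 0 ≤ k * det3 P Q X} := by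
  intro X hX Y hY s t hs ht hst
  rw [Set.mem_ofPred_eq] at *
  have h1 : k * det3 P Q (s • X + t • Y) = s * (k * det3 P Q X) + t * (k * det3 P Q Y) := by
    obtain rfl : s = 1 - t := by linarith
    simp only [det3, PiLp.add_apply, PiLp.smul_apply, smul_eq_mul]
    ring
  rw [h1]
  positivity

theorem volume_triangle_lt_top (P Q R : Plane) : volume (convexHull ℝ {P, Q, R}) ≠ ⊤ := by
  rw [volume_triangle]
  exact ENNReal.ofReal_ne_top

/-- The two triangles lie in opposite closed half planes of `OB`, so they overlap only in a subset
of a line, which is a null set. -/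
theorem Quad.area_eq {Q : Quad} (hOB : Q.O ≠ Q.B)
    (h : det3 Q.O Q.B Q.A * det3 Q.O Q.B Q.C < 0) :
    Q.area = |det3 Q.O Q.A Q.B| / 2 + |det3 Q.O Q.B Q.C| / 2 := by
  have hA : det3 Q.O Q.B Q.A ≠ 0 := left_ne_zero_of_mul h.ne
  have hsub : convexHull ℝ {Q.O, Q.A, Q.B} ∩ convexHull ℝ {Q.O, Q.B, Q.C} ⊆
      (line[ℝ, Q.O, Q.B] : Set Plane) := by
    rintro X ⟨h1, h2⟩
    have h3 : X ∈ {X : Plane | 0 ≤ det3 Q.O Q.B Q.A * det3 Q.O Q.B X} := by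
      refine convexHull_min ?_ (convex_half_plane _ _ _) h1
      rintro Y (rfl | rfl | rfl)
      · simp [det3]
      · rw [Set.mem_ofPred_eq]; exact mul_self_nonneg _
      · simp [det3, mul_comm]
    have h4 : X ∈ {X : Plane | 0 ≤ (-det3 Q.O Q.B Q.A) * det3 Q.O Q.B X} := by
      refine convexHull_min ?_ (convex_half_plane _ _ _) h2
      rintro Y (rfl | rfl | rfl)
      · simp [det3]
      · simp [det3, mul_comm]
      · rw [Set.mem_ofPred_eq]; linarith
    rw [Set.mem_ofPred_eq] at h3 h4
    have h5 : det3 Q.O Q.B Q.A * det3 Q.O Q.B X = 0 := by linarith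
    exact (mem_line_iff hOB).2 ((mul_eq_zero.1 h5).resolve_left hA)
  have hnull : volume (line[ℝ, Q.O, Q.B] : Set Plane) = 0 := by
    refine Measure.addHaar_affineSubspace _ _ fun htop => hA ?_
    rw [← mem_line_iff hOB, htop]
    exact AffineSubspace.mem_top _ _ _
  have hmeas : NullMeasurableSet (convexHull ℝ {Q.O, Q.B, Q.C}) volume :=
    (convex_convexHull ℝ _).nullMeasurableSet volume
  rw [Quad.area, Quad.region, if_pos ((sOppSide_iff hOB).2 h),
    measure_union₀ hmeas (measure_mono_null hsub hnull),
    ENNReal.toReal_add (volume_triangle_lt_top _ _ _) (volume_triangle_lt_top _ _ _),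
    volume_triangle, volume_triangle, ENNReal.toReal_ofReal (by positivity),
    ENNReal.toReal_ofReal (by positivity)]
  rfl

/-! ### From the geometric hypotheses to coordinates -/

theorem Quad.IsQuadrilateral.exists_tangentConfig {Q : Quad} (hQ : Q.IsQuadrilateral)
    {S : Sphere Plane} (hS : Q.IsExcircle S) (hB : Q.LiesOutsideB S) :
    ∃ u s w v : ℝ, TangentConfig (Q.A 0 - Q.O 0) (Q.A 1 - Q.O 1) (Q.B 0 - Q.O 0) (Q.B 1 - Q.O 1)
      (Q.C 0 - Q.O 0) (Q.C 1 - Q.O 1) (S.center 0 - Q.O 0) (S.center 1 - Q.O 1) S.radius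
      u s w v := by
  obtain ⟨t₁, o₁, n₁⟩ := exists_contact hS.tangent_OA
  obtain ⟨t₂, o₂, n₂⟩ := exists_contact hS.tangent_AB
  obtain ⟨t₃, o₃, n₃⟩ := exists_contact hS.tangent_BC
  obtain ⟨t₄, o₄, n₄⟩ := exists_contact hS.tangent_CO
  have hAB := ne_of_not_collinear hQ.not_collinear_ABC
  have hBC := ne_of_not_collinear hQ.not_collinear_BCO
  have sAB := (sOppSide_iff hAB).1 hB.1
  have sBC := (sOppSide_iff hBC).1 hB.2
  have dABC := det3_ne_zero hQ.not_collinear_ABC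
  have dCOA := det3_ne_zero hQ.not_collinear_COA
  -- The contacts on `BC` and `CO` are parametrised from `B` and from `C`, whereas the configuration
  -- counts from `C` and from `O`.
  refine ⟨t₁, t₂, 1 - t₃, 1 - t₄, hS.radius_pos, ?_, ?_, ?_, ?_, ?_, ?_, ?_, ?_, ?_, ?_, ?_, ?_,
    ?_, ?_⟩
  · linear_combination o₁
  · linear_combination n₁
  · linear_combination o₂
  · linear_combination n₂
  · linear_combination -o₃
  · linear_combination n₃
  · linear_combination -o₄
  · linear_combination n₄
  · simp only [det3] at sAB
    linarith
  · simp only [det3] at sBC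
    linarith
  · refine fun h => dCOA ?_
    simp only [det3]
    linear_combination h
  · refine fun h => dABC ?_
    simp only [det3]
    linear_combination h
  · rintro ⟨h1, h2⟩
    refine not_disjoint_openSegment ?_ ?_ hQ.disjoint_OA_BC
    · simp only [det3]
      linarith
    · simp only [det3]
      linarith
  · rintro ⟨h1, h2⟩
    refine not_disjoint_openSegment ?_ ?_ hQ.disjoint_AB_CO
    · simp only [det3]
      linarith
    · simp only [det3]
      linarith

theorem theorem3 (Q : Quad) (hLEQ : Q.IsLEQ) (hext : Q.IsExtangential) (hkite : ¬ Q.IsKite) :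
    ∃ s t : ℤ, Q.Sig = (s : ℝ) ∧ Q.Tau = (t : ℝ) ∧
      ((s = 9 ∧ t = 18) ∨ (s = 18 ∧ t = 50) ∨
        (∃ m n Y Z : ℤ, s = 5 * m ^ 2 ∧ t = 5 * m ^ 2 + 5 ∧
          m ^ 2 - 10 * n ^ 2 = -1 ∧ (5 * m ^ 2 - 8) * Y ^ 2 = 5 + 8 * Z ^ 2) ∨
        (∃ m n Y Z : ℤ, s = m ^ 2 ∧ t = m ^ 2 + 1 ∧
          m ^ 2 - 2 * n ^ 2 = -1 ∧ (m ^ 2 - 8) * Y ^ 2 = 1 + 8 * Z ^ 2)) := by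
  obtain ⟨S, hS, hB⟩ := hext
  have hQ := hLEQ.isQuadrilateral
  obtain ⟨u, s, w, v, h⟩ := hQ.exists_tangentConfig hS hB
  have coord : ∀ P ∈ ({Q.O, Q.A, Q.B, Q.C} : Set Plane), ∀ i : Fin 2,
      ∃ n : ℤ, P i - Q.O i = n := by
    intro P hP i
    obtain ⟨m, hm⟩ := hLEQ.isLattice P hP i
    obtain ⟨n, hn⟩ := hLEQ.isLattice Q.O (by simp) i
    exact ⟨m - n, by rw [hm, hn]; push_cast; rfl⟩
  have hOA := ne_of_not_collinear hQ.not_collinear_OAB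
  have hAB := ne_of_not_collinear hQ.not_collinear_ABC
  have hBC := ne_of_not_collinear hQ.not_collinear_BCO
  have hCO := ne_of_not_collinear hQ.not_collinear_COA
  have hdOAB := det3_ne_zero hQ.not_collinear_OAB
  have hOB : Q.O ≠ Q.B := fun he => hdOAB (by rw [← he]; simp [det3])
  have hDC : det3 Q.O Q.A Q.C ≠ 0 := by
    have := det3_ne_zero hQ.not_collinear_COA
    contrapose! this
    simp only [det3] at this ⊢
    linear_combination this
  have ha2 : Q.a ^ 2 = _ := dist_sq_eq Q.O Q.A
  have hb2 : Q.b ^ 2 = _ := dist_sq_eq Q.A Q.B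
  have hc2 : Q.c ^ 2 = _ := dist_sq_eq Q.B Q.C
  have hd2 : Q.d ^ 2 = _ := dist_sq_eq Q.C Q.O
  have harea : 0 < det3 Q.O Q.A Q.B * det3 Q.O Q.B Q.C →
      |det3 Q.O Q.A Q.B + det3 Q.O Q.B Q.C| / 2 = Q.a + Q.b + Q.c + Q.d := by
    intro hp
    -- Equal orientations of `OAB` and `OBC` mean that `OB` separates `A` from `C`, so the region is
    -- cut along `OB` and the two absolute areas add.
    have hopp : det3 Q.O Q.B Q.A * det3 Q.O Q.B Q.C < 0 := by
      simp only [det3] at hp ⊢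
      linarith
    rw [← Quad.perimeter, ← hLEQ.area_eq_perimeter, Quad.area_eq hOB hopp, ← add_div]
    congr 1
    exact abs_add_eq_add_abs_iff _ _ |>.2 (by
      rcases mul_pos_iff.1 hp with ⟨h1, h2⟩ | ⟨h1, h2⟩
      · exact Or.inl ⟨h1.le, h2.le⟩
      · exact Or.inr ⟨h1.le, h2.le⟩)
  obtain ⟨a₁, ha₁⟩ := coord Q.A (by simp) 0
  obtain ⟨a₂, ha₂⟩ := coord Q.A (by simp) 1
  obtain ⟨b₁, hb₁⟩ := coord Q.B (by simp) 0
  obtain ⟨b₂, hb₂⟩ := coord Q.B (by simp) 1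
  obtain ⟨c₁, hc₁⟩ := coord Q.C (by simp) 0
  obtain ⟨c₂, hc₂⟩ := coord Q.C (by simp) 1
  rw [ha₁, ha₂, hb₁, hb₂, hc₁, hc₂] at h
  refine h.conclusion (dist_pos.2 hOA) (dist_pos.2 hAB) (dist_pos.2 hBC) (dist_pos.2 hCO)
    ?_ ?_ ?_ ?_ (fun hk => hkite (Or.inl hk)) ?_ ?_
  · rw [ha2, ← ha₁, ← ha₂]; ring
  · rw [hb2, ← ha₁, ← ha₂, ← hb₁, ← hb₂]; ring
  · rw [hc2, ← hc₁, ← hc₂, ← hb₁, ← hb₂]; ring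
  · rw [hd2, ← hc₁, ← hc₂]
  · rw [← ha₁, ← ha₂, ← hb₁, ← hb₂, ← hc₁, ← hc₂]
    exact harea
  · rw [← ha₁, ← ha₂, ← hb₁, ← hb₂, ← hc₁, ← hc₂]
    simp only [sub_sub_sub_cancel_right]
    by_cases hw : Q.BWithinCircumcircle
    · exact Or.inl ⟨(within_iff hDC).1 hw, if_pos hw⟩
    · exact Or.inr ⟨not_lt.1 fun hlt => hw ((within_iff hDC).2 hlt), if_neg hw⟩
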